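/- Let $H$ be a complex Hilbert space with a fixed orthonormal basis $(e_j)$. For bounded operators $A,B$ on $H$ let $A\circ B$ be their Hadamard product, i.e. the bounded operator with $\langle (A\circ B)e_i,e_j\rangle=\langle Ae_i,e_j\rangle\langle Be_i,e_j\rangle$ for all $i,j$. For $r\in[0,1]$ let $A\,\sharp_r B$ be the weighted geometric mean of positive operators: $A\,\sharp_r B=A^{1/2}(A^{-1/2}BA^{-1/2})^rA^{1/2}$ if $A,B$ are positive and invertible, and for arbitrary positive $A,B$ it is the limit of $(A+\varepsilon I)\,\sharp_r(B+\varepsilon I)$ as $\varepsilon\downarrow0$ in the strong operator topology. The order on operators is $X\le Y$ iff $Y-X$ is positive. An integral $\int_T f\,d\mu$ of an operator-valued field $f$ is the (unique, if it exists) bounded operator $S$ such that, for every bounded linear functional $\varphi$ on $\mathbb B(H)$, $\varphi\circ f$ is integrable and $\varphi(S)=\int_T\varphi(f(t))\,d\mu(t)$; it is the Bochner integral whenever $f$ is Bochner integrable. Theorem. Let $T$ be a compact Hausdorff space equipped with a Radon measure $\mu$ and with a total order $\preceq$. Let $(A_t)_{t\in T}$ and $(B_t)_{t\in T}$ be norm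 continuous fields of positive operators on $H$ which are increasing, i.e. $t\preceq s$ implies $A_t\le A_s$ and $B_t\le B_s$. Let $\alpha:T\to[0,\infty)$ be measurable with $\int_T\alpha\,d\mu<\infty$. Then, for every $r\in[0,1]$, the field $\alpha(t)(A_t\circ B_t)$ is Bochner integrable, the fields $\alpha(t)(A_t\,\sharp_r B_t)$ and $\alpha(t)(A_t\,\sharp_{1-r}B_t)$ have integrals in the above sense, and $$\int_T\alpha(s)\,d\mu(s)\int_T\alpha(t)(A_t\circ B_t)\,d\mu(t)\;\ge\;\Big(\int_T\alpha(t)(A_t\,\sharp_r B_t)\,d\mu(t)\Big)\circ\Big(\int_T\alpha(s)(A_s\,\sharp_{1-r}B_s)\,d\mu(s)\Big).$$ -/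

import Mathlib

open MeasureTheory Filter Topology

open scoped ENNReal InnerProductSpace

namespace OperatorChebyshev

section Hadamard

variable {H : Type*} [NormedAddCommGroup H] [InnerProductSpace ℂ H]
  {ι : Type*} (e : HilbertBasis ι ℂ H)

theorem hasSum_norm_sq_inner (v : H) :
    HasSum (fun j => ‖inner ℂ (e j) v‖ ^ 2) (‖v‖ ^ 2) := by
  have h := lp.hasSum_norm (p := 2) (by norm_num) (e.repr v)
  simpa [e.repr_apply_apply] using h

theorem summable_entries (A : H →L[ℂ] H) (x : H) :
    (Summable fun p : ι × ι => ‖inner ℂ (e p.1) x * inner ℂ (e p.2) (A (e p.1))‖ ^ 2) ∧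
      ∑' p : ι × ι, ‖inner ℂ (e p.1) x * inner ℂ (e p.2) (A (e p.1))‖ ^ 2 ≤
        (‖A‖ * ‖x‖) ^ 2 := by
  have hx := hasSum_norm_sq_inner e x
  have hrow (i : ι) : HasSum
      (fun j => ‖inner ℂ (e i) x * inner ℂ (e j) (A (e i))‖ ^ 2)
      (‖inner ℂ (e i) x‖ ^ 2 * ‖A (e i)‖ ^ 2) := by
    simpa [mul_pow] using (hasSum_norm_sq_inner e (A (e i))).mul_left (‖inner ℂ (e i) x‖ ^ 2)
  have hle (i : ι) : ‖inner ℂ (e i) x‖ ^ 2 * ‖A (e i)‖ ^ 2 ≤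
      ‖inner ℂ (e i) x‖ ^ 2 * ‖A‖ ^ 2 := by
    have h1 : ‖A (e i)‖ ≤ ‖A‖ := by
      simpa [e.orthonormal.1 i] using A.le_opNorm (e i)
    gcongr
  have hs : Summable fun i => ‖inner ℂ (e i) x‖ ^ 2 * ‖A (e i)‖ ^ 2 :=
    Summable.of_nonneg_of_le (fun i => by positivity) hle (hx.summable.mul_right _)
  have hsum : Summable fun p : ι × ι =>
      ‖inner ℂ (e p.1) x * inner ℂ (e p.2) (A (e p.1))‖ ^ 2 := by
    rw [summable_prod_of_nonneg (fun p => by positivity)]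
    refine ⟨fun i => (hrow i).summable, ?_⟩
    simpa only [(hrow _).tsum_eq] using hs
  refine ⟨hsum, ?_⟩
  rw [hsum.tsum_prod]
  simp only [(hrow _).tsum_eq]
  calc ∑' i, ‖inner ℂ (e i) x‖ ^ 2 * ‖A (e i)‖ ^ 2
      ≤ ∑' i, ‖inner ℂ (e i) x‖ ^ 2 * ‖A‖ ^ 2 := hs.tsum_le_tsum hle (hx.summable.mul_right _)
    _ = (‖A‖ * ‖x‖) ^ 2 := by rw [tsum_mul_right, hx.tsum_eq]; ring

/-- The operator `x ↦ (⟨e i, x⟩ ⟨e j, A (e i)⟩)_(i, j)` from `H` to `ℓ²(ι × ι)`, with the index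
pairs permuted by `σ`. Auxiliary: used only to show that the Hadamard product exists. -/
noncomputable def entryMap (σ : ι × ι ≃ ι × ι) (A : H →L[ℂ] H) :
    H →L[ℂ] lp (fun _ : ι × ι => ℂ) 2 :=
  LinearMap.mkContinuous
    { toFun := fun x =>
        ⟨fun p => inner ℂ (e (σ p).1) x * inner ℂ (e (σ p).2) (A (e (σ p).1)),
          memℓp_gen (by simpa [Function.comp_def] using σ.summable_iff.mpr (summable_entries e A x).1)⟩
      map_add' := fun x y => by
        ext p
        simp only [inner_add_right, add_mul]
        rfl
      map_smul' := fun c x => by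
        ext p
        simp [mul_assoc] }
    ‖A‖ (fun x => by
      refine le_of_sq_le_sq ?_ (by positivity)
      have h := lp.norm_rpow_eq_tsum (p := 2) (by norm_num)
        (⟨fun p => inner ℂ (e (σ p).1) x * inner ℂ (e (σ p).2) (A (e (σ p).1)),
          memℓp_gen (by simpa [Function.comp_def] using σ.summable_iff.mpr (summable_entries e A x).1)⟩ :
            lp (fun _ : ι × ι => ℂ) 2)
      have h2 := (summable_entries e A x).2
      rw [← σ.tsum_eq] at h2
      simp only [ENNReal.toReal_ofNat, Real.rpow_ofNat] at h
      exact h.trans_le h2)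

theorem entryMap_apply (σ : ι × ι ≃ ι × ι) (A : H →L[ℂ] H) (x : H) (p : ι × ι) :
    entryMap e σ A x p = inner ℂ (e (σ p).1) x * inner ℂ (e (σ p).2) (A (e (σ p).1)) := rfl

/-- For any two bounded operators there is exactly one bounded operator whose matrix in the
orthonormal basis `e` is the entrywise product of their matrices. -/
theorem existsUnique_hadamard [CompleteSpace H] (A B : H →L[ℂ] H) :
    ∃! C : H →L[ℂ] H, ∀ i j : ι,
      inner ℂ (e j) (C (e i)) = inner ℂ (e j) (A (e i)) * inner ℂ (e j) (B (e i)) := by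
  classical
  have horth := orthonormal_iff_ite.mp e.orthonormal
  refine ⟨(ContinuousLinearMap.adjoint (entryMap e (Equiv.prodComm ι ι)
      (ContinuousLinearMap.adjoint B))).comp (entryMap e (Equiv.refl _) A), ?_, ?_⟩
  · intro i j
    rw [ContinuousLinearMap.comp_apply, ContinuousLinearMap.adjoint_inner_right,
      lp.inner_eq_tsum, tsum_eq_single (i, j)]
    · simp [entryMap_apply, e.orthonormal.1, ContinuousLinearMap.adjoint_inner_right]
    · rintro ⟨k, l⟩ hkl
      by_cases hk : k = i
      · have hl : l ≠ j := fun hl => hkl (by rw [hk, hl])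
        simp [entryMap_apply, horth, hl]
      · simp [entryMap_apply, horth, hk]
  · intro D hD
    refine ContinuousLinearMap.ext_on
      (Submodule.dense_iff_topologicalClosure_eq_top.mpr e.dense_span) ?_
    rintro _ ⟨i, rfl⟩
    refine e.repr.injective (lp.ext (funext fun j => ?_))
    rw [e.repr_apply_apply, e.repr_apply_apply, hD i j]
    rw [ContinuousLinearMap.comp_apply, ContinuousLinearMap.adjoint_inner_right,
      lp.inner_eq_tsum, tsum_eq_single (i, j)]
    · simp [entryMap_apply, e.orthonormal.1, ContinuousLinearMap.adjoint_inner_right]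
    · rintro ⟨k, l⟩ hkl
      by_cases hk : k = i
      · have hl : l ≠ j := fun hl => hkl (by rw [hk, hl])
        simp [entryMap_apply, horth, hl]
      · simp [entryMap_apply, horth, hk]

/-- The Hadamard (entrywise) product of two bounded operators in the orthonormal basis `e`:
the bounded operator `A ∘ B` with `⟨e j, (A ∘ B) (e i)⟩ = ⟨e j, A (e i)⟩ ⟨e j, B (e i)⟩`. -/
noncomputable def hadamardProd [CompleteSpace H] (A B : H →L[ℂ] H) : H →L[ℂ] H :=
  (existsUnique_hadamard e A B).choose

theorem hadamardProd_spec [CompleteSpace H] (A B : H →L[ℂ] H) (i j : ι) :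
    inner ℂ (e j) (hadamardProd e A B (e i)) =
      inner ℂ (e j) (A (e i)) * inner ℂ (e j) (B (e i)) :=
  (existsUnique_hadamard e A B).choose_spec.1 i j

end Hadamard

section GeometricMean

variable {H : Type*} [NormedAddCommGroup H] [InnerProductSpace ℂ H] [CompleteSpace H]

/-- `A^{1/2} (A^{-1/2} B A^{-1/2})^r A^{1/2}`, for strictly positive (positive and invertible)
operators `A`, `B`; the powers are those of the continuous functional calculus. -/
noncomputable def strictGeomMean (r : ℝ) (A B : H →L[ℂ] H) : H →L[ℂ] H :=
  A ^ (1 / 2 : ℝ) * (A ^ (-(1 / 2) : ℝ) * B * A ^ (-(1 / 2) : ℝ)) ^ r * A ^ (1 / 2 : ℝ)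

/-- `M` is the limit of `(A + ε I) ♯_r (B + ε I)` as `ε ↓ 0` in the strong operator topology. -/
def IsGeomMean (r : ℝ) (A B M : H →L[ℂ] H) : Prop :=
  ∀ x : H, Tendsto
    (fun ε : ℝ => strictGeomMean r (A + ε • (1 : H →L[ℂ] H)) (B + ε • (1 : H →L[ℂ] H)) x)
    (𝓝[>] 0) (𝓝 (M x))

open Classical in
/-- The weighted geometric mean `A ♯_r B` of positive operators, as an operator mean: the strong
limit of `(A + ε I) ♯_r (B + ε I)` as `ε ↓ 0`. This limit exists for all positive `A`, `B` and all
`r ∈ [0, 1]`, since the net decreases with `ε` and is bounded below by `0`. -/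
noncomputable def geomMean (r : ℝ) (A B : H →L[ℂ] H) : H →L[ℂ] H :=
  if h : ∃ M : H →L[ℂ] H, IsGeomMean r A B M then h.choose else 0

end GeometricMean

section Integral

variable {T : Type*} [MeasurableSpace T] {E : Type*} [NormedAddCommGroup E] [NormedSpace ℂ E]

/-- `S` is the (weak) integral of the field `f`: for every functional `φ` in the norm dual,
`t ↦ φ (f t)` is integrable and `φ S = ∫ φ (f t) dμ(t)`. By the Hahn-Banach theorem there is at
most one such `S`, and it is the Bochner integral whenever `f` is Bochner integrable. -/
def HasWeakIntegral (f : T → E) (μ : Measure T) (S : E) : Prop :=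
  ∀ φ : StrongDual ℂ E, Integrable (fun t => φ (f t)) μ ∧ φ S = ∫ t, φ (f t) ∂μ

end Integral

end OperatorChebyshev

open OperatorChebyshev

/-!
The inequality splits as
`(∫ α (A ♯_r B)) ∘ (∫ α (A ♯_{1-r} B)) ≤ (∫ α A) ∘ (∫ α B) ≤ (∫ α) ∫ α (A ∘ B)`.

The second step is the Chebyshev argument: the fields increase together, so
`(A t - A s) ∘ (B t - B s) ≥ 0` by the Schur product theorem, and this is integrated in `s` and in
`t` (`hadamardProd_integral_le`).

The first step is the integrated form of the pointwise inequality
`(A ♯_r B) ∘ (C ♯_{1-r} D) ≤ r (B ∘ C) + (1 - r) (A ∘ D)` (`hadamardProd_geomMean_le`). For strictly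
positive operators put `X = A^{-1/2} B A^{-1/2}` and `Y = C^{-1/2} D C^{-1/2}`; the claim is then
Young's inequality `x ^ r * y ^ (1 - r) ≤ r * x + (1 - r) * y` for the commuting pair `X ⊗ 1`,
`1 ⊗ Y`, carried to the Hadamard product by the positive bilinear map
`(x, y) ↦ (A^{1/2} x A^{1/2}) ∘ (C^{1/2} y C^{1/2})`. No tensor product is needed: Bernstein
polynomials approximate `X` and `Y` and their powers by positive combinations of positive operators,
for which Young's inequality holds term by term (`map_rpow_map_rpow_le`). Strong limits give the
general case.

The geometric mean of positive operators exists as the strong limit of a decreasing net;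
monotonicity of the net, and of the mean, comes from operator monotonicity of
`x ↦ x ^ r` in the second variable and the symmetry `A ♯_r B = B ♯_{1-r} A` (`conj_rpow_comm`) in the first.

The field `f t = A t ♯_r B t` is increasing but need not be norm continuous, so the existence of its
integral is not automatic. It is a monotone function of the norm continuous increasing field
`k t = (A t, B t)`. For a real functional `ψ`, the supremum of `ψ`
over the order interval `[-f t, f t]` serves as a variation function for `ψ ∘ f`, so `ψ ∘ f` is a
difference of monotone functions of `k`, and such functions are Borel measurable
(`measurable_of_monotone_of_factors`). Cutting `T` into intervals on which `k` is constant up to a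
set of small measure (`exists_interval_partition`) gives Riemann sums in norm, which converge to a
weak integral at a rate that is uniform over functionals of norm at most one
(`exists_approx_integral`).
-/

namespace OperatorChebyshev

/-! ### A Young inequality for positive bilinear maps -/

section Young

variable {E : Type*} [CStarAlgebra E] [PartialOrder E] [StarOrderedRing E]

/-- Bernstein approximation in the functional calculus: a positive element `a` is approximately
diagonalised by positive elements `d n k` with eigenvalues `x n k`, simultaneously for all
continuous functions of `a`. -/
theorem exists_tendsto_sum_smul_cfc {a : E} (ha : 0 ≤ a) :
    ∃ (d : ∀ n : ℕ, Fin (n + 1) → E) (x : ∀ n : ℕ, Fin (n + 1) → ℝ),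
      (∀ n k, 0 ≤ d n k) ∧ (∀ n k, 0 ≤ x n k) ∧ ∀ f : ℝ → ℝ, Continuous f →
        Tendsto (fun n => ∑ k, f (x n k) • d n k) atTop (𝓝 (cfc f a)) := by
  set N : ℝ := ‖a‖ + 1 with hN
  have hN0 : 0 < N := by positivity
  -- the spectrum of `a` is rescaled into the unit interval
  let π : ℝ → unitInterval := fun t => Set.projIcc 0 1 zero_le_one (t / N)
  have hπ : Continuous π := continuous_projIcc.comp (continuous_id.div_const N)
  have hπN : ∀ t ∈ spectrum ℝ a, N * (π t : ℝ) = t := by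
    intro t ht
    have h0 : 0 ≤ t := spectrum_nonneg_of_nonneg ha ht
    have h1 : t ≤ N := by
      have h2 := (IsSelfAdjoint.le_algebraMap_norm_self (IsSelfAdjoint.of_nonneg ha))
      rw [le_algebraMap_iff_spectrum_le] at h2
      have := h2 t ht
      linarith
    have : t / N ∈ Set.Icc (0 : ℝ) 1 := ⟨by positivity, by rw [div_le_one hN0]; exact h1⟩
    simp only [π, Set.projIcc_of_mem zero_le_one this]
    field_simp
  refine ⟨fun n k => cfc (fun t => bernstein n k (π t)) a, fun n k => N * (bernstein.z k : ℝ),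
    fun n k => cfc_nonneg fun t _ => bernstein_nonneg,
    fun n k => mul_nonneg hN0.le (bernstein.z k).2.1, fun f hf => ?_⟩
  let g : C(unitInterval, ℝ) := ⟨fun s => f (N * s), by fun_prop⟩
  have hsum : ∀ n : ℕ, ∑ k : Fin (n + 1), f (N * (bernstein.z k : ℝ)) •
      cfc (fun t => bernstein n k (π t)) a = cfc (fun t => bernsteinApproximation n g (π t)) a := by
    intro n
    have hc (k : Fin (n + 1)) : Continuous fun t => bernstein n k (π t) :=
      (bernstein n k).continuous.comp hπ
    simp only [bernsteinApproximation.apply]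
    rw [show (fun t => ∑ k : Fin (n + 1), bernstein n k (π t) • g (bernstein.z k)) =
        ∑ k : Fin (n + 1), fun t => bernstein n k (π t) • g (bernstein.z k) by ext; simp,
      cfc_sum_univ (fun (k : Fin (n + 1)) t => bernstein n k (π t) • g (bernstein.z k)) a
      (fun k => ((hc k).smul continuous_const).continuousOn)]
    refine Finset.sum_congr rfl fun k _ => ?_
    rw [← cfc_smul _ _ _ (hc k).continuousOn]
    simp [g, mul_comm]
  simp only [hsum]
  have hfg : cfc f a = cfc (fun t => g (π t)) a :=
    cfc_congr fun t ht => by simp [g, hπN t ht]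
  rw [hfg]
  refine tendsto_cfc_fun ?_ (Eventually.of_forall fun n =>
    ((bernsteinApproximation n g).continuous.comp hπ).continuousOn)
  have h := ContinuousMap.tendsto_iff_tendstoUniformly.mp (bernsteinApproximation_uniform g)
  exact (h.comp π).tendstoUniformlyOn

variable {F : Type*} [NormedAddCommGroup F] [NormedSpace ℝ F] [PartialOrder F]
  [IsOrderedAddMonoid F] [PosSMulMono ℝ F] [OrderClosedTopology F]

/-- The Young inequality `s ^ r * t ^ (1 - r) ≤ r * s + (1 - r) * t` for two operators that need
not act on the same space, combined through a positive bilinear map (such as a compression of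
the tensor product). -/
theorem map_rpow_map_rpow_le (Φ : E →L[ℝ] E →L[ℝ] F) (hΦ : ∀ a b, 0 ≤ a → 0 ≤ b → 0 ≤ Φ a b)
    {a b : E} (ha : 0 ≤ a) (hb : 0 ≤ b) {r : ℝ} (hr : r ∈ Set.Icc (0 : ℝ) 1) :
    Φ (a ^ r) (b ^ (1 - r)) ≤ r • Φ a 1 + (1 - r) • Φ 1 b := by
  obtain ⟨d, x, hd, hx, hlim⟩ := exists_tendsto_sum_smul_cfc ha
  obtain ⟨d', y, hd', hy, hlim'⟩ := exists_tendsto_sum_smul_cfc hb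
  have hr' : 0 ≤ 1 - r := by linarith [hr.2]
  have hexp (n : ℕ) (f g : ℝ → ℝ) : Φ (∑ k, f (x n k) • d n k) (∑ j, g (y n j) • d' n j) =
      ∑ k, ∑ j, (f (x n k) * g (y n j)) • Φ (d n k) (d' n j) := by
    rw [map_sum Φ, sum_apply]
    refine Finset.sum_congr rfl fun k _ => ?_
    rw [map_sum (Φ _)]
    refine Finset.sum_congr rfl fun j _ => ?_
    rw [map_smul, map_smul, smul_apply, smul_smul, mul_comm]
  have hΦlim (f g : ℝ → ℝ) (hf : Continuous f) (hg : Continuous g) :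
      Tendsto (fun n => ∑ k, ∑ j, (f (x n k) * g (y n j)) • Φ (d n k) (d' n j)) atTop
        (𝓝 (Φ (cfc f a) (cfc g b))) := by
    simp only [← hexp]
    have h := (Φ.continuous₂.tendsto (cfc f a, cfc g b)).comp
      ((hlim f hf).prodMk_nhds (hlim' g hg))
    exact h
  have h1 := hΦlim (fun t => t ^ r) (fun t => t ^ (1 - r))
    (Real.continuous_rpow_const hr.1) (Real.continuous_rpow_const hr')
  have h2 := hΦlim (fun t => t) (fun _ => 1) continuous_id continuous_const
  have h3 := hΦlim (fun _ => 1) (fun t => t) continuous_const continuous_id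
  rw [← CFC.rpow_eq_cfc_real ha, ← CFC.rpow_eq_cfc_real hb] at h1
  rw [cfc_const_one ℝ b hb.isSelfAdjoint, cfc_id' ℝ a ha.isSelfAdjoint] at h2
  rw [cfc_const_one ℝ a ha.isSelfAdjoint, cfc_id' ℝ b hb.isSelfAdjoint] at h3
  have h4 : Tendsto (fun n => r • (∑ k, ∑ j, (x n k * 1) • Φ (d n k) (d' n j)) +
      (1 - r) • (∑ k, ∑ j, (1 * y n j) • Φ (d n k) (d' n j))) atTop
      (𝓝 (r • Φ a 1 + (1 - r) • Φ 1 b)) := (h2.const_smul r).add (h3.const_smul (1 - r))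
  refine le_of_tendsto_of_tendsto' h1 h4 fun n => ?_
  simp only [Finset.smul_sum, ← Finset.sum_add_distrib, smul_smul, ← add_smul]
  refine Finset.sum_le_sum fun k _ => Finset.sum_le_sum fun j _ => ?_
  have hkj : 0 ≤ Φ (d n k) (d' n j) := hΦ _ _ (hd _ _) (hd' _ _)
  refine smul_le_smul_of_nonneg_right ?_ hkj
  have := Real.geom_mean_le_arith_mean2_weighted hr.1 hr' (hx n k) (hy n j) (by ring)
  linarith

end Young

/-! ### Weighted geometric means of strictly positive operators -/

section StrictGeomMean

section Algebra

variable {E : Type*} [CStarAlgebra E] [PartialOrder E] [StarOrderedRing E]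

theorem unitary_conj_rpow {u : E} (hu : u ∈ unitary E) {a : E} (ha : IsStrictlyPositive a) (s : ℝ) :
    (u * a * star u) ^ s = u * a ^ s * star u := by
  have ha0 : 0 ≤ a := ha.nonneg
  let φ := Unitary.conjStarAlgAut ℝ E ⟨u, hu⟩
  have hφ (x : E) : φ x = u * x * star u := rfl
  have hφa : 0 ≤ u * a * star u := star_right_conjugate_nonneg ha0 u
  have hφc : Continuous φ := by
    have : (φ : E → E) = fun x => u * x * star u := rfl
    rw [this]; fun_prop
  have hcont : ContinuousOn (fun t : ℝ => t ^ s) (spectrum ℝ a) := fun t ht =>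
    (Real.continuousAt_rpow_const t s (Or.inl fun h =>
      spectrum.zero_notMem ℝ ha.isUnit (h ▸ ht))).continuousWithinAt
  rw [CFC.rpow_eq_cfc_real ha0, CFC.rpow_eq_cfc_real hφa, ← hφ, ← hφ]
  exact (StarAlgHomClass.map_cfc (S := ℝ) φ (fun t : ℝ => t ^ s) a hcont hφc
    ha0.isSelfAdjoint hφa.isSelfAdjoint).symm

theorem _root_.IsStrictlyPositive.rpow_half_mul_self {a : E} (ha : IsStrictlyPositive a) :
    a ^ (1 / 2 : ℝ) * a ^ (1 / 2 : ℝ) = a := by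
  rw [← CFC.rpow_add ha.isUnit, add_halves, CFC.rpow_one a ha.nonneg]

theorem _root_.IsStrictlyPositive.conj_rpow {a b : E} (ha : IsStrictlyPositive a)
    (hb : IsStrictlyPositive b) (s : ℝ) : IsStrictlyPositive (a ^ s * b * a ^ s) :=
  ⟨conjugate_nonneg_of_nonneg hb.nonneg CFC.rpow_nonneg,
    ((ha.rpow a s).isUnit.mul hb.isUnit).mul (ha.rpow a s).isUnit⟩

/-- The symmetry `a ♯_r b = b ♯_{1-r} a`. With `X = b^{1/2} a^{-1/2}`, the two arguments
`a^{-1/2} b a^{-1/2} = X* X` and `b^{-1/2} a b^{-1/2} = (X X*)⁻¹` of the powers are related by the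
unitary part of the polar decomposition of `X`. -/
theorem conj_rpow_comm {a b : E} (ha : IsStrictlyPositive a) (hb : IsStrictlyPositive b) (r : ℝ) :
    a ^ (1 / 2 : ℝ) * (a ^ (-(1 / 2) : ℝ) * b * a ^ (-(1 / 2) : ℝ)) ^ r * a ^ (1 / 2 : ℝ) =
      b ^ (1 / 2 : ℝ) * (b ^ (-(1 / 2) : ℝ) * a * b ^ (-(1 / 2) : ℝ)) ^ (1 - r) *
        b ^ (1 / 2 : ℝ) := by
  have hT := ha.conj_rpow hb (-(1 / 2))
  have hpp := ha.rpow_half_mul_self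
  have hqq := hb.rpow_half_mul_self
  have hpi : a ^ (1 / 2 : ℝ) * a ^ (-(1 / 2) : ℝ) = 1 := CFC.rpow_mul_rpow_neg _ ha
  have hip : a ^ (-(1 / 2) : ℝ) * a ^ (1 / 2 : ℝ) = 1 := CFC.rpow_neg_mul_rpow _ ha
  have hqi : b ^ (1 / 2 : ℝ) * b ^ (-(1 / 2) : ℝ) = 1 := CFC.rpow_mul_rpow_neg _ hb
  have hiq : b ^ (-(1 / 2) : ℝ) * b ^ (1 / 2 : ℝ) = 1 := CFC.rpow_neg_mul_rpow _ hb
  have hpu : IsUnit (a ^ (-(1 / 2) : ℝ)) := (ha.rpow a _).isUnit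
  have hqu : IsUnit (b ^ (1 / 2 : ℝ)) := (hb.rpow b _).isUnit
  have hps : star (a ^ (-(1 / 2) : ℝ)) = a ^ (-(1 / 2) : ℝ) :=
    (IsSelfAdjoint.of_nonneg CFC.rpow_nonneg).star_eq
  have hqs : star (b ^ (1 / 2 : ℝ)) = b ^ (1 / 2 : ℝ) :=
    (IsSelfAdjoint.of_nonneg CFC.rpow_nonneg).star_eq
  set p := a ^ (1 / 2 : ℝ)
  set p' := a ^ (-(1 / 2) : ℝ)
  set q := b ^ (1 / 2 : ℝ)
  set q' := b ^ (-(1 / 2) : ℝ)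
  set T := p' * b * p' with hTdef
  have hTs : star (T ^ (-(1 / 2) : ℝ)) = T ^ (-(1 / 2) : ℝ) :=
    (IsSelfAdjoint.of_nonneg CFC.rpow_nonneg).star_eq
  have hTone : T ^ (1 : ℝ) = T := CFC.rpow_one T hT.nonneg
  -- the unitary part of `q * p'`
  set u := q * p' * T ^ (-(1 / 2) : ℝ) with hu
  have hsu : star u = T ^ (-(1 / 2) : ℝ) * p' * q := by
    rw [hu, star_mul, star_mul, hTs, hps, hqs, mul_assoc]
  have hsuu : star u * u = 1 := by
    calc star u * u = T ^ (-(1 / 2) : ℝ) * (p' * (q * q) * p') * T ^ (-(1 / 2) : ℝ) := by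
          rw [hsu, hu]; noncomm_ring
      _ = T ^ (-(1 / 2) : ℝ) * T ^ (1 : ℝ) * T ^ (-(1 / 2) : ℝ) := by rw [hqq, ← hTdef, hTone]
      _ = 1 := by
          rw [← CFC.rpow_add hT.isUnit, ← CFC.rpow_add hT.isUnit]
          norm_num [CFC.rpow_zero T hT.nonneg]
  have huu : IsUnit u := (hqu.mul hpu).mul (hT.rpow T _).isUnit
  have huus : u * star u = 1 := by
    obtain ⟨v, hv⟩ := huu.exists_right_inv
    rwa [left_inv_eq_right_inv hsuu hv]
  have humem : u ∈ unitary E := Unitary.mem_iff.mpr ⟨hsuu, huus⟩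
  have hconj (s t : ℝ) : u * T ^ s * star u * (u * T ^ t * star u) = u * T ^ (s + t) * star u := by
    rw [CFC.rpow_add hT.isUnit]
    calc u * T ^ s * star u * (u * T ^ t * star u)
        = u * T ^ s * (star u * u) * T ^ t * star u := by noncomm_ring
      _ = _ := by rw [hsuu]; noncomm_ring
  have hW : q' * a * q' = u * T ^ (-1 : ℝ) * star u := by
    have h1 : u * T ^ (1 : ℝ) * star u = q * (p' * p') * q := by
      calc u * T ^ (1 : ℝ) * star u
          = q * p' * (T ^ (-(1 / 2) : ℝ) * T ^ (1 : ℝ) * T ^ (-(1 / 2) : ℝ)) * (p' * q) := by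
            rw [hsu, hu]; noncomm_ring
        _ = q * p' * 1 * (p' * q) := by
            rw [← CFC.rpow_add hT.isUnit, ← CFC.rpow_add hT.isUnit]
            norm_num [CFC.rpow_zero T hT.nonneg]
        _ = _ := by noncomm_ring
    refine left_inv_eq_right_inv (a := u * T ^ (1 : ℝ) * star u) ?_ ?_
    · calc q' * a * q' * (u * T ^ (1 : ℝ) * star u)
          = q' * (p * p) * (q' * q) * (p' * p') * q := by rw [h1, hpp]; noncomm_ring
        _ = q' * p * (p * p') * p' * q := by rw [hiq]; noncomm_ring
        _ = q' * (p * p') * q := by simp only [hpi, mul_one, mul_assoc _ p p']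
        _ = 1 := by rw [hpi, mul_one, hiq]
    · rw [hconj, add_neg_cancel, CFC.rpow_zero T hT.nonneg, mul_one, huus]
  rw [hW, unitary_conj_rpow humem (hT.rpow T _), CFC.rpow_rpow T _ _ (by norm_num) hT]
  have hqX : q * q * p' = p * T := by
    rw [hqq, hTdef, ← mul_assoc, ← mul_assoc, hpi, one_mul]
  have hXq : p' * (q * q) = T * p := by
    rw [hqq, hTdef, mul_assoc, hip, mul_one]
  calc p * T ^ r * p
      = p * (T ^ (1 : ℝ) * T ^ (-(1 / 2) : ℝ) * T ^ (-1 * (1 - r)) * T ^ (-(1 / 2) : ℝ)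
          * T ^ (1 : ℝ)) * p := by
        simp only [← CFC.rpow_add hT.isUnit]
        congr 3
        ring_nf
    _ = p * T * T ^ (-(1 / 2) : ℝ) * T ^ (-1 * (1 - r)) * T ^ (-(1 / 2) : ℝ) * (T * p) := by
        rw [hTone]; noncomm_ring
    _ = q * (u * T ^ (-1 * (1 - r)) * star u) * q := by
        rw [← hqX, ← hXq, hsu, hu]; noncomm_ring

end Algebra

variable {H : Type*} [NormedAddCommGroup H] [InnerProductSpace ℂ H] [CompleteSpace H]
  {r : ℝ} {A B A' B' : H →L[ℂ] H}

theorem strictGeomMean_nonneg (r : ℝ) (A B : H →L[ℂ] H) :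
    0 ≤ strictGeomMean r A B :=
  conjugate_nonneg_of_nonneg CFC.rpow_nonneg CFC.rpow_nonneg

theorem strictGeomMean_comm (hA : IsStrictlyPositive A) (hB : IsStrictlyPositive B) (r : ℝ) :
    strictGeomMean r A B = strictGeomMean (1 - r) B A :=
  conj_rpow_comm hA hB r

theorem strictGeomMean_self (hA : IsStrictlyPositive A) (r : ℝ) : strictGeomMean r A A = A := by
  have h : A ^ (-(1 / 2) : ℝ) * A * A ^ (-(1 / 2) : ℝ) = 1 := by
    nth_rw 2 [← CFC.rpow_one A hA.nonneg]
    rw [← CFC.rpow_add hA.isUnit, ← CFC.rpow_add hA.isUnit]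
    norm_num [CFC.rpow_zero A hA.nonneg]
  rw [strictGeomMean, h, CFC.one_rpow, mul_one, hA.rpow_half_mul_self]

theorem strictGeomMean_mono_right (hr : r ∈ Set.Icc (0 : ℝ) 1)
    (h : B ≤ B') : strictGeomMean r A B ≤ strictGeomMean r A B' :=
  conjugate_le_conjugate_of_nonneg
    (CFC.monotone_rpow hr (conjugate_le_conjugate_of_nonneg h CFC.rpow_nonneg)) CFC.rpow_nonneg

theorem strictGeomMean_mono (hA : IsStrictlyPositive A)
    (hA' : IsStrictlyPositive A') (hB' : IsStrictlyPositive B') (hr : r ∈ Set.Icc (0 : ℝ) 1)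
    (hAA' : A ≤ A') (hBB' : B ≤ B') : strictGeomMean r A B ≤ strictGeomMean r A' B' := by
  refine (strictGeomMean_mono_right hr hBB').trans ?_
  rw [strictGeomMean_comm hA hB', strictGeomMean_comm hA' hB']
  exact strictGeomMean_mono_right ⟨by linarith [hr.2], by linarith [hr.1]⟩ hAA'

end StrictGeomMean

/-! ### Strong limits and the geometric mean of positive operators -/

section GeomMean

open scoped ComplexOrder

variable {H : Type*} [NormedAddCommGroup H] [InnerProductSpace ℂ H]

theorem nonneg_iff_inner_nonneg {A : H →L[ℂ] H} : 0 ≤ A ↔ ∀ x, 0 ≤ inner ℂ x (A x) := by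
  rw [ContinuousLinearMap.nonneg_iff_isPositive]
  refine ⟨fun h x => h.inner_nonneg_right x, fun h => ?_⟩
  rw [ContinuousLinearMap.isPositive_iff_complex]
  intro x
  have h1 : 0 ≤ inner ℂ (A x) x := by
    rw [← inner_conj_symm]
    simpa using star_nonneg_iff.mpr (h x)
  obtain ⟨h2, h3⟩ := Complex.nonneg_iff.mp h1
  exact ⟨Complex.ext rfl (by simpa using h3), h2⟩

theorem nonneg_of_tendsto_apply {α : Type*} {l : Filter α} [l.NeBot] {f : α → H →L[ℂ] H}
    {A : H →L[ℂ] H} (h : ∀ x, Tendsto (fun a => f a x) l (𝓝 (A x))) (hf : ∀ᶠ a in l, 0 ≤ f a) :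
    0 ≤ A :=
  nonneg_iff_inner_nonneg.mpr fun x => ge_of_tendsto (tendsto_const_nhds.inner (h x))
    (hf.mono fun _ ha => nonneg_iff_inner_nonneg.mp ha x)

variable [CompleteSpace H]

theorem le_of_tendsto_apply {α : Type*} {l : Filter α} [l.NeBot] {f g : α → H →L[ℂ] H}
    {A B : H →L[ℂ] H} (hA : ∀ x, Tendsto (fun a => f a x) l (𝓝 (A x)))
    (hB : ∀ x, Tendsto (fun a => g a x) l (𝓝 (B x))) (hfg : ∀ᶠ a in l, f a ≤ g a) :
    A ≤ B :=
  sub_nonneg.mp <| nonneg_of_tendsto_apply (f := fun a => g a - f a)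
    (fun x => (hB x).sub (hA x)) (hfg.mono fun _ ha => sub_nonneg.mpr ha)

theorem norm_apply_sq_le {P : H →L[ℂ] H} (hP : 0 ≤ P) (x : H) :
    ‖P x‖ ^ 2 ≤ ‖P‖ * (inner ℂ x (P x)).re := by
  set S := CFC.sqrt P
  have hS : S * S = P := CFC.sqrt_mul_sqrt_self P hP
  have hSa : IsSelfAdjoint S := (CFC.sqrt_nonneg P).isSelfAdjoint
  have h1 : (inner ℂ x (P x)).re = ‖S x‖ ^ 2 := by
    rw [← hS, mul_apply_eq_comp, ← ContinuousLinearMap.adjoint_inner_left,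
      ← ContinuousLinearMap.star_eq_adjoint, hSa.star_eq, inner_self_eq_norm_sq_to_K]
    norm_cast
  have h2 : ‖P‖ = ‖S‖ ^ 2 := by
    rw [← hS, hSa.norm_mul_self]
  rw [h1, h2, ← mul_pow]
  refine pow_le_pow_left₀ (norm_nonneg _) ?_ 2
  conv_lhs => rw [← hS, mul_apply_eq_comp]
  exact S.le_opNorm _

/-- A decreasing net of positive operators converges strongly. -/
theorem exists_tendsto_apply_of_monotoneOn {M : ℝ → H →L[ℂ] H}
    (h0 : ∀ ε, 0 < ε → 0 ≤ M ε) (hM : MonotoneOn M (Set.Ioi 0)) :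
    ∃ L : H →L[ℂ] H, ∀ x, Tendsto (fun ε => M ε x) (𝓝[>] 0) (𝓝 (L x)) := by
  have hnorm : ∀ ε ∈ Set.Ioc (0 : ℝ) 1, ‖M ε‖ ≤ ‖M 1‖ := fun ε hε =>
    CStarAlgebra.norm_le_norm_of_nonneg_of_le (h0 ε hε.1)
      (hM (Set.mem_Ioi.mpr hε.1) (Set.mem_Ioi.mpr one_pos) hε.2)
  have hlim : ∀ x, ∃ y, Tendsto (fun ε => M ε x) (𝓝[>] 0) (𝓝 y) := by
    intro x
    let g : ℝ → ℝ := fun ε => (inner ℂ x (M ε x)).re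
    -- differences of the net are controlled by the scalar net `⟨x, M ε x⟩`
    have hdiff : ∀ ε ∈ Set.Ioc (0 : ℝ) 1, ∀ δ ∈ Set.Ioc (0 : ℝ) 1, ε ≤ δ →
        ‖M δ x - M ε x‖ ^ 2 ≤ ‖M 1‖ * (g δ - g ε) ∧ g ε ≤ g δ := by
      intro ε hε δ hδ hle
      have hpos : 0 ≤ M δ - M ε :=
        sub_nonneg.mpr (hM (Set.mem_Ioi.mpr hε.1) (Set.mem_Ioi.mpr hδ.1) hle)
      have h1 := norm_apply_sq_le hpos x
      have hg : (inner ℂ x ((M δ - M ε) x)).re = g δ - g ε := by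
        simp [g]
      have hg0 : 0 ≤ g δ - g ε :=
        hg ▸ (Complex.nonneg_iff.mp (nonneg_iff_inner_nonneg.mp hpos x)).1
      have h2 : ‖M δ - M ε‖ ≤ ‖M 1‖ :=
        (CStarAlgebra.norm_le_norm_of_nonneg_of_le hpos
          (sub_le_self _ (h0 ε hε.1))).trans (hnorm δ hδ)
      rw [hg] at h1
      exact ⟨h1.trans (mul_le_mul_of_nonneg_right h2 hg0), sub_nonneg.mp hg0⟩
    have hgmono : MonotoneOn g (Set.Ioi 0) := fun ε hε δ hδ hle => by
      have hpos : 0 ≤ M δ - M ε := sub_nonneg.mpr (hM hε hδ hle)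
      have := (Complex.nonneg_iff.mp (nonneg_iff_inner_nonneg.mp hpos x)).1
      simpa [g, inner_sub_right] using this
    have hgbdd : BddBelow (g '' Set.Ioi 0) :=
      ⟨0, by
        rintro _ ⟨ε, hε, rfl⟩
        exact (Complex.nonneg_iff.mp (nonneg_iff_inner_nonneg.mp (h0 ε hε) x)).1⟩
    have hg := MonotoneOn.tendsto_nhdsGT hgmono hgbdd
    set c := sInf (g '' Set.Ioi 0)
    have hcauchy : Cauchy (map (fun ε => M ε x) (𝓝[>] (0 : ℝ))) := by
      rw [Metric.cauchy_iff]
      refine ⟨inferInstance, fun η hη => ?_⟩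
      set K := ‖M 1‖ + 1
      have hK : 0 < K := by positivity
      have hev : ∀ᶠ ε in 𝓝[>] (0 : ℝ), ε ∈ Set.Ioc (0 : ℝ) 1 ∧ |g ε - c| < η ^ 2 / (2 * K) :=
        Filter.Eventually.and (Ioc_mem_nhdsGT one_pos) (Metric.tendsto_nhds.mp hg _ (by positivity))
      refine ⟨_, image_mem_map hev, ?_⟩
      have key : ∀ ε δ, (ε ∈ Set.Ioc (0 : ℝ) 1 ∧ |g ε - c| < η ^ 2 / (2 * K)) →
          (δ ∈ Set.Ioc (0 : ℝ) 1 ∧ |g δ - c| < η ^ 2 / (2 * K)) → ε ≤ δ →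
          ‖M δ x - M ε x‖ < η := by
        rintro ε δ ⟨hε, hε'⟩ ⟨hδ, hδ'⟩ hle
        obtain ⟨h1, h2⟩ := hdiff ε hε δ hδ hle
        have h3 : g δ - g ε < η ^ 2 / K := by
          have : η ^ 2 / K = η ^ 2 / (2 * K) + η ^ 2 / (2 * K) := by field_simp; ring
          rw [abs_lt] at hε' hδ'
          linarith [hε'.1, hδ'.2]
        have h4 : ‖M δ x - M ε x‖ ^ 2 < η ^ 2 :=
          calc ‖M δ x - M ε x‖ ^ 2 ≤ ‖M 1‖ * (g δ - g ε) := h1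
            _ ≤ K * (g δ - g ε) :=
              mul_le_mul_of_nonneg_right (by simp [K]) (sub_nonneg.mpr h2)
            _ < K * (η ^ 2 / K) := mul_lt_mul_of_pos_left h3 hK
            _ = η ^ 2 := by field_simp
        exact lt_of_pow_lt_pow_left₀ 2 hη.le h4
      rintro _ ⟨ε, hε, rfl⟩ _ ⟨δ, hδ, rfl⟩
      rcases le_total ε δ with hle | hle
      · rw [dist_comm, dist_eq_norm]; exact key ε δ hε hδ hle
      · rw [dist_eq_norm]; exact key δ ε hδ hε hle
    exact CompleteSpace.complete hcauchy
  choose f hf using hlim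
  have hseq : Tendsto (fun n : ℕ => 1 / ((n : ℝ) + 1)) atTop (𝓝[>] 0) :=
    tendsto_nhdsWithin_iff.mpr ⟨tendsto_one_div_add_atTop_nhds_zero_nat,
      Eventually.of_forall fun n => Set.mem_Ioi.mpr (by positivity)⟩
  refine ⟨ContinuousLinearMap.ofTendstoOfBoundedRange f
    (fun n : ℕ => M (1 / ((n : ℝ) + 1))) (l := atTop)
    (tendsto_pi_nhds.mpr fun x => (hf x).comp hseq) ?_, hf⟩
  rw [isBounded_iff_forall_norm_le]
  refine ⟨‖M 1‖, ?_⟩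
  rintro _ ⟨n, rfl⟩
  refine hnorm _ ⟨by positivity, ?_⟩
  rw [div_le_one (by positivity)]
  linarith [(Nat.cast_nonneg n : (0 : ℝ) ≤ n)]

variable {r : ℝ} {A B A' B' : H →L[ℂ] H}

theorem isStrictlyPositive_add_smul_one (hA : 0 ≤ A) {ε : ℝ} (hε : 0 < ε) :
    IsStrictlyPositive (A + ε • (1 : H →L[ℂ] H)) :=
  IsStrictlyPositive.nonneg_add hA (isStrictlyPositive_one.smul hε)

theorem isGeomMean_geomMean (hr : r ∈ Set.Icc (0 : ℝ) 1) (hA : 0 ≤ A) (hB : 0 ≤ B) :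
    IsGeomMean r A B (geomMean r A B) := by
  have h : ∃ M : H →L[ℂ] H, IsGeomMean r A B M := by
    refine exists_tendsto_apply_of_monotoneOn (fun ε _ => strictGeomMean_nonneg _ _ _) ?_
    intro ε hε δ hδ hle
    have hle' : ε • (1 : H →L[ℂ] H) ≤ δ • 1 := smul_le_smul_of_nonneg_right hle zero_le_one
    exact strictGeomMean_mono (isStrictlyPositive_add_smul_one hA hε)
      (isStrictlyPositive_add_smul_one hA hδ) (isStrictlyPositive_add_smul_one hB hδ) hr
      (add_le_add_right hle' A) (add_le_add_right hle' B)
  rw [geomMean, dif_pos h]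
  exact h.choose_spec

theorem geomMean_nonneg (hr : r ∈ Set.Icc (0 : ℝ) 1) (hA : 0 ≤ A) (hB : 0 ≤ B) :
    0 ≤ geomMean r A B :=
  nonneg_of_tendsto_apply (isGeomMean_geomMean hr hA hB)
    (Eventually.of_forall fun _ => strictGeomMean_nonneg _ _ _)

theorem geomMean_mono (hr : r ∈ Set.Icc (0 : ℝ) 1) (hA : 0 ≤ A) (hB : 0 ≤ B)
    (hAA' : A ≤ A') (hBB' : B ≤ B') : geomMean r A B ≤ geomMean r A' B' := by
  refine le_of_tendsto_apply (isGeomMean_geomMean hr hA hB)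
    (isGeomMean_geomMean hr (hA.trans hAA') (hB.trans hBB')) ?_
  filter_upwards [self_mem_nhdsWithin] with ε hε
  exact strictGeomMean_mono (isStrictlyPositive_add_smul_one hA hε)
    (isStrictlyPositive_add_smul_one (hA.trans hAA') hε)
    (isStrictlyPositive_add_smul_one (hB.trans hBB') hε) hr
    (add_le_add_left hAA' _) (add_le_add_left hBB' _)

theorem tendsto_add_smul_one (A : H →L[ℂ] H) :
    Tendsto (fun ε : ℝ => A + ε • (1 : H →L[ℂ] H)) (𝓝[>] 0) (𝓝 A) := by
  have h : Continuous fun ε : ℝ => A + ε • (1 : H →L[ℂ] H) := by fun_prop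
  simpa using (h.tendsto 0).mono_left nhdsWithin_le_nhds

theorem geomMean_self (hr : r ∈ Set.Icc (0 : ℝ) 1) (hA : 0 ≤ A) : geomMean r A A = A := by
  ext x
  refine tendsto_nhds_unique (isGeomMean_geomMean hr hA hA x) ?_
  have h : Tendsto (fun ε : ℝ => (A + ε • (1 : H →L[ℂ] H)) x) (𝓝[>] 0) (𝓝 (A x)) :=
    ((ContinuousLinearMap.apply ℂ H x).continuous.tendsto A).comp (tendsto_add_smul_one A)
  refine h.congr' ?_
  filter_upwards [self_mem_nhdsWithin] with ε hε
  rw [strictGeomMean_self (isStrictlyPositive_add_smul_one hA hε)]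

theorem geomMean_le_add (hr : r ∈ Set.Icc (0 : ℝ) 1) (hA : 0 ≤ A) (hB : 0 ≤ B) :
    geomMean r A B ≤ A + B :=
  (geomMean_mono hr hA hB (le_add_of_nonneg_right hB) (le_add_of_nonneg_left hA)).trans
    (geomMean_self hr (add_nonneg hA hB)).le

end GeomMean

/-! ### The Hadamard product as a positive bilinear map -/

section HadamardPositivity

open scoped ComplexOrder

variable {H : Type*} [NormedAddCommGroup H] [InnerProductSpace ℂ H]
  {ι : Type*} (e : HilbertBasis ι ℂ H)

theorem inner_linearCombination_apply (A : H →L[ℂ] H) (x : ι →₀ ℂ) :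
    inner ℂ (Finsupp.linearCombination ℂ e x) (A (Finsupp.linearCombination ℂ e x)) =
      x.sum fun i xi => x.sum fun j xj => star xi * inner ℂ (e i) (A (e j)) * xj := by
  simp only [Finsupp.linearCombination_apply, Finsupp.sum, map_sum, map_smul, sum_inner, inner_sum,
    inner_smul_left, inner_smul_right, Finset.mul_sum]
  rw [Finset.sum_comm]
  refine Finset.sum_congr rfl fun i _ => Finset.sum_congr rfl fun j _ => ?_
  simp only [RCLike.star_def]
  ring

/-- Positivity is a property of the finite sections of the matrix. -/
theorem nonneg_iff_entries {A : H →L[ℂ] H} : 0 ≤ A ↔ ∀ x : ι →₀ ℂ,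
    0 ≤ x.sum fun i xi => x.sum fun j xj => star xi * inner ℂ (e i) (A (e j)) * xj := by
  simp only [← inner_linearCombination_apply e A]
  refine ⟨fun h x => nonneg_iff_inner_nonneg.mp h _,
    fun h => nonneg_iff_inner_nonneg.mpr fun v => ?_⟩
  have hd : Dense (Submodule.span ℂ (Set.range e) : Set H) :=
    Submodule.dense_iff_topologicalClosure_eq_top.mpr e.dense_span
  have hc : IsClosed {v : H | 0 ≤ inner ℂ v (A v)} :=
    isClosed_Ici.preimage (continuous_id.inner (𝕜 := ℂ) A.continuous)
  refine hc.closure_subset_iff.mpr ?_ (hd v)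
  intro w hw
  obtain ⟨x, rfl⟩ := Finsupp.mem_span_range_iff_exists_finsupp.mp hw
  exact h x

theorem nonneg_of_tendsto_entries {α : Type*} {l : Filter α} [l.NeBot] {f : α → H →L[ℂ] H}
    {A : H →L[ℂ] H}
    (h : ∀ i j, Tendsto (fun a => inner ℂ (e j) (f a (e i))) l (𝓝 (inner ℂ (e j) (A (e i)))))
    (hf : ∀ᶠ a in l, 0 ≤ f a) : 0 ≤ A := by
  refine (nonneg_iff_entries e).mpr fun x => ?_
  refine ge_of_tendsto (tendsto_finsetSum _ fun i _ => tendsto_finsetSum _ fun j _ =>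
    ((h j i).const_mul _).mul_const _) (hf.mono fun a ha => ?_)
  exact (nonneg_iff_entries e).mp ha x

variable [CompleteSpace H]

theorem posSemidef_entries {A : H →L[ℂ] H} (hA : 0 ≤ A) :
    (Matrix.of fun i j => inner ℂ (e i) (A (e j))).PosSemidef := by
  refine ⟨?_, (nonneg_iff_entries e).mp hA⟩
  ext i j
  simp only [Matrix.conjTranspose_apply, Matrix.of_apply, RCLike.star_def, inner_conj_symm]
  rw [← ContinuousLinearMap.adjoint_inner_right, ← ContinuousLinearMap.star_eq_adjoint,
    hA.isSelfAdjoint.star_eq]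

theorem hadamardProd_eq {A B C : H →L[ℂ] H} (h : ∀ i j : ι,
      inner ℂ (e j) (C (e i)) = inner ℂ (e j) (A (e i)) * inner ℂ (e j) (B (e i))) :
    hadamardProd e A B = C :=
  ((existsUnique_hadamard e A B).choose_spec.2 C h).symm

/-- The Schur product theorem. -/
theorem hadamardProd_nonneg {A B : H →L[ℂ] H} (hA : 0 ≤ A) (hB : 0 ≤ B) :
    0 ≤ hadamardProd e A B := by
  refine (nonneg_iff_entries e).mpr fun x => ?_
  simpa only [Matrix.hadamard_apply, Matrix.of_apply, ← hadamardProd_spec] using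
    ((posSemidef_entries e hA).hadamard (posSemidef_entries e hB)).2 x

theorem hadamardProd_comm (A B : H →L[ℂ] H) : hadamardProd e A B = hadamardProd e B A :=
  hadamardProd_eq e fun i j => by rw [hadamardProd_spec, mul_comm]

theorem norm_hadamardProd_le (A B : H →L[ℂ] H) : ‖hadamardProd e A B‖ ≤ ‖A‖ * ‖B‖ := by
  classical
  have horth := orthonormal_iff_ite.mp e.orthonormal
  have hnorm (σ : ι × ι ≃ ι × ι) (C : H →L[ℂ] H) : ‖entryMap e σ C‖ ≤ ‖C‖ :=
    LinearMap.mkContinuous_norm_le _ (norm_nonneg C) _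
  -- a factorisation through `ℓ²(ι × ι)`
  rw [hadamardProd_eq e (C := (ContinuousLinearMap.adjoint (entryMap e (Equiv.prodComm ι ι)
      (ContinuousLinearMap.adjoint B))).comp (entryMap e (Equiv.refl _) A))]
  · refine (ContinuousLinearMap.opNorm_comp_le _ _).trans ?_
    rw [LinearIsometryEquiv.norm_map, mul_comm]
    refine mul_le_mul (hnorm _ _) ((hnorm _ _).trans_eq ?_) (norm_nonneg _) (norm_nonneg _)
    exact LinearIsometryEquiv.norm_map _ _
  · intro i j
    rw [ContinuousLinearMap.comp_apply, ContinuousLinearMap.adjoint_inner_right,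
      lp.inner_eq_tsum, tsum_eq_single (i, j)]
    · simp [entryMap_apply, e.orthonormal.1, ContinuousLinearMap.adjoint_inner_right]
    · rintro ⟨k, l⟩ hkl
      by_cases hk : k = i
      · have hl : l ≠ j := fun hl => hkl (by rw [hk, hl])
        simp [entryMap_apply, horth, hl]
      · simp [entryMap_apply, horth, hk]

/-- The Hadamard product as a bounded bilinear map. -/
noncomputable def hadamardCLM : (H →L[ℂ] H) →L[ℂ] (H →L[ℂ] H) →L[ℂ] (H →L[ℂ] H) :=
  LinearMap.mkContinuous₂
    (LinearMap.mk₂ ℂ (hadamardProd e)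
      (fun A A' B => hadamardProd_eq e fun i j => by
        simp [hadamardProd_spec, add_mul])
      (fun c A B => hadamardProd_eq e fun i j => by
        simp [hadamardProd_spec, mul_assoc])
      (fun A B B' => hadamardProd_eq e fun i j => by
        simp [hadamardProd_spec, mul_add])
      (fun c A B => hadamardProd_eq e fun i j => by
        simp [hadamardProd_spec, mul_left_comm]))
    1 fun A B => by simpa using norm_hadamardProd_le e A B

@[simp] theorem hadamardCLM_apply (A B : H →L[ℂ] H) : hadamardCLM e A B = hadamardProd e A B := rfl

/-- The compression to the diagonal of the Young inequality for `(A ♯_r B) ⊗ (C ♯_{1-r} D)`. -/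
theorem hadamardProd_strictGeomMean_le {A B C D : H →L[ℂ] H} (hA : IsStrictlyPositive A)
    (hB : IsStrictlyPositive B) (hC : IsStrictlyPositive C) (hD : IsStrictlyPositive D)
    {r : ℝ} (hr : r ∈ Set.Icc (0 : ℝ) 1) :
    hadamardProd e (strictGeomMean r A B) (strictGeomMean (1 - r) C D) ≤
      r • hadamardProd e B C + (1 - r) • hadamardProd e A D := by
  set p := A ^ (1 / 2 : ℝ) with hp
  set q := C ^ (1 / 2 : ℝ) with hq
  let Φ : (H →L[ℂ] H) →L[ℝ] (H →L[ℂ] H) →L[ℝ] (H →L[ℂ] H) :=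
    (hadamardCLM e).bilinearRestrictScalars ℝ |>.bilinearComp
      (ContinuousLinearMap.mulLeftRight ℝ (H →L[ℂ] H) p p)
      (ContinuousLinearMap.mulLeftRight ℝ (H →L[ℂ] H) q q)
  have hΦ (X Y : H →L[ℂ] H) : Φ X Y = hadamardProd e (p * X * p) (q * Y * q) := rfl
  have h := map_rpow_map_rpow_le Φ
    (fun X Y hX hY => by
      rw [hΦ]
      exact hadamardProd_nonneg e (conjugate_nonneg_of_nonneg hX CFC.rpow_nonneg)
        (conjugate_nonneg_of_nonneg hY CFC.rpow_nonneg))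
    (hA.conj_rpow hB (-(1 / 2))).nonneg (hC.conj_rpow hD (-(1 / 2))).nonneg hr
  have hcancel {P X : H →L[ℂ] H} (hP : IsStrictlyPositive P) :
      P ^ (1 / 2 : ℝ) * (P ^ (-(1 / 2) : ℝ) * X * P ^ (-(1 / 2) : ℝ)) * P ^ (1 / 2 : ℝ) = X := by
    calc _ = (P ^ (1 / 2 : ℝ) * P ^ (-(1 / 2) : ℝ)) * X *
          (P ^ (-(1 / 2) : ℝ) * P ^ (1 / 2 : ℝ)) := by simp only [mul_assoc]
      _ = X := by rw [CFC.rpow_mul_rpow_neg _ hP, CFC.rpow_neg_mul_rpow _ hP, one_mul, mul_one]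
  simp only [hΦ, mul_one] at h
  rw [hp, hq, hcancel hA, hcancel hC, hA.rpow_half_mul_self, hC.rpow_half_mul_self] at h
  exact h

theorem hadamardProd_geomMean_le {A B C D : H →L[ℂ] H} (hA : 0 ≤ A) (hB : 0 ≤ B) (hC : 0 ≤ C)
    (hD : 0 ≤ D) {r : ℝ} (hr : r ∈ Set.Icc (0 : ℝ) 1) :
    hadamardProd e (geomMean r A B) (geomMean (1 - r) C D) ≤
      r • hadamardProd e B C + (1 - r) • hadamardProd e A D := by
  have hr' : 1 - r ∈ Set.Icc (0 : ℝ) 1 := ⟨by linarith [hr.2], by linarith [hr.1]⟩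
  have hAB := isGeomMean_geomMean hr hA hB
  have hCD := isGeomMean_geomMean hr' hC hD
  have hlim {X Y : H →L[ℂ] H} : Tendsto (fun ε : ℝ => hadamardProd e (X + ε • (1 : H →L[ℂ] H))
      (Y + ε • (1 : H →L[ℂ] H))) (𝓝[>] 0) (𝓝 (hadamardProd e X Y)) := by
    have h := ((hadamardCLM e).continuous₂.tendsto (X, Y)).comp
      ((tendsto_add_smul_one X).prodMk_nhds (tendsto_add_smul_one Y))
    exact h
  rw [← sub_nonneg]
  refine nonneg_of_tendsto_entries (l := 𝓝[>] (0 : ℝ)) e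
    (f := fun ε => (r • hadamardProd e (B + ε • 1) (C + ε • 1) +
      (1 - r) • hadamardProd e (A + ε • 1) (D + ε • 1)) -
      hadamardProd e (strictGeomMean r (A + ε • 1) (B + ε • 1))
        (strictGeomMean (1 - r) (C + ε • 1) (D + ε • 1))) ?_ ?_
  · intro i j
    simp only [sub_apply, inner_sub_right, hadamardProd_spec e (strictGeomMean r _ _),
      hadamardProd_spec e (geomMean r _ _)]
    have h1 : Tendsto (fun ε : ℝ =>
        r • hadamardProd e (B + ε • (1 : H →L[ℂ] H)) (C + ε • (1 : H →L[ℂ] H)) +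
          (1 - r) • hadamardProd e (A + ε • (1 : H →L[ℂ] H)) (D + ε • (1 : H →L[ℂ] H)))
        (𝓝[>] 0) (𝓝 (r • hadamardProd e B C + (1 - r) • hadamardProd e A D)) :=
      (hlim.const_smul r).add (hlim.const_smul (1 - r))
    have h2 := ((ContinuousLinearMap.apply ℂ H (e i)).continuous.tendsto _).comp h1
    have h3 := (tendsto_const_nhds (x := e j)).inner (𝕜 := ℂ) h2
    have h4 := ((tendsto_const_nhds (x := e j)).inner (𝕜 := ℂ) (hAB (e i))).mul
      ((tendsto_const_nhds (x := e j)).inner (𝕜 := ℂ) (hCD (e i)))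
    exact h3.sub h4
  · filter_upwards [self_mem_nhdsWithin] with ε hε
    exact sub_nonneg.mpr (hadamardProd_strictGeomMean_le e
      (isStrictlyPositive_add_smul_one hA hε) (isStrictlyPositive_add_smul_one hB hε)
      (isStrictlyPositive_add_smul_one hC hε) (isStrictlyPositive_add_smul_one hD hε) hr)

end HadamardPositivity

/-! ### Monotone functions of a continuous chain -/

section Chain

/-- Continuity from below along uncountable chains of open sets: the range of `k` is compact
metrizable, hence hereditarily Lindelöf. -/
theorem measure_biUnion_preimage_le {T : Type*} [TopologicalSpace T] [CompactSpace T]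
    [MeasurableSpace T] {Y : Type*} [PseudoMetricSpace Y] {k : T → Y} (ν : Measure T)
    (hk : Continuous k) {O : T → Set Y} (hO : ∀ t, IsOpen (O t))
    {J : Set T} (hJ : ∀ s ∈ J, ∀ t ∈ J, k ⁻¹' O s ⊆ k ⁻¹' O t ∨ k ⁻¹' O t ⊆ k ⁻¹' O s)
    {a : ℝ≥0∞} (ha : ∀ t ∈ J, ν (k ⁻¹' O t) ≤ a) : ν (⋃ t ∈ J, k ⁻¹' O t) ≤ a := by
  have : CompactSpace (Set.range k) := isCompact_iff_compactSpace.mp (isCompact_range hk)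
  obtain ⟨J', hJ', hU⟩ := TopologicalSpace.isOpen_iUnion_countable
    (fun t : J => (Subtype.val ⁻¹' O t : Set (Set.range k)))
    fun t => (hO t).preimage continuous_subtype_val
  have hU' : ⋃ t ∈ J, k ⁻¹' O t = ⋃ t ∈ J', k ⁻¹' O (t : T) := by
    have h := congrArg (fun s => Set.rangeFactorization k ⁻¹' s) hU
    simp only [Set.preimage_iUnion] at h
    rw [Set.biUnion_eq_iUnion]
    exact h.symm
  rw [hU', measure_biUnion_eq_iSup hJ']
  · exact iSup₂_le fun t _ => ha t t.2
  · intro s hs t ht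
    rcases hJ s s.2 t t.2 with h | h
    · exact ⟨t, ht, h, subset_rfl⟩
    · exact ⟨s, hs, subset_rfl, h⟩

variable {T : Type*} [TopologicalSpace T] [LinearOrder T] [MeasurableSpace T] [BorelSpace T]
  {Y : Type*} [PartialOrder Y] {k : T → Y}

/-- A monotone function of a continuous increasing field is Borel measurable, although the order
of `T` need not be related to its topology: its superlevel sets are closed or open, according to
whether or not the field attains a minimum on them. -/
theorem measurable_of_monotone_of_factors [TopologicalSpace Y] [OrderClosedTopology Y]
    (hk : Continuous k) (hkm : Monotone k)
    {p : T → ℝ} (hp : Monotone p) (hpk : ∀ s t, k s = k t → p s = p t) : Measurable p := by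
  refine measurable_of_Ioi fun c => ?_
  by_cases h : ∃ t₀, c < p t₀ ∧ ∀ u, c < p u → k t₀ ≤ k u
  · obtain ⟨t₀, ht₀, hmin⟩ := h
    have : p ⁻¹' Set.Ioi c = {t | k t₀ ≤ k t} := by
      ext t
      refine ⟨fun ht => hmin t ht, fun ht => ?_⟩
      rcases le_total t₀ t with hle | hle
      · exact ht₀.trans_le (hp hle)
      · exact ht₀.trans_eq (hpk _ _ (le_antisymm ht (hkm hle)))
    rw [this]
    exact (isClosed_le continuous_const hk).measurableSet
  · push Not at h
    have : p ⁻¹' Set.Ioi c = ⋃ v ∈ p ⁻¹' Set.Ioi c, {t | ¬ k t ≤ k v} := by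
      ext t
      simp only [Set.mem_iUnion, Set.mem_preimage, Set.mem_Ioi, Set.mem_ofPred_eq, exists_prop]
      refine ⟨fun ht => h t ht, fun ⟨v, hv, htv⟩ => ?_⟩
      have hvt : v ≤ t := le_of_not_ge fun hle => htv (hkm hle)
      exact hv.trans_le (hp hvt)
    rw [this]
    exact (isOpen_biUnion fun v _ => (isClosed_le hk continuous_const).isOpen_compl).measurableSet

variable [CompactSpace T] [PseudoMetricSpace Y] (ν : Measure T)
  [OrderClosedTopology Y] [IsFiniteMeasure ν]

/-- The chain splits into finitely many measurable order intervals `q = j` such that `k` is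
constant on each of them apart from a set `P j` of measure at most `δ`. The intervals are cut out
by the values of the distribution function `t ↦ ν {s | k s < k t}`. -/
theorem exists_interval_partition (hk : Continuous k) (hkm : Monotone k) {δ : ℝ} (hδ : 0 < δ) :
    ∃ (N : ℕ) (q : T → ℕ) (P : ℕ → Set T), Monotone q ∧ (∀ t, q t < N) ∧ Measurable q ∧
      (∀ j, MeasurableSet (P j)) ∧ (∀ j, P j ⊆ q ⁻¹' {j}) ∧ (∀ j, ν.real (P j) ≤ δ) ∧
      ∀ s t, q s = q t → s ∉ P (q s) → t ∉ P (q t) → k s = k t := by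
  let L : T → Set T := fun t => k ⁻¹' {y | ¬ k t ≤ y}
  have hLo (t : T) : IsOpen {y | ¬ k t ≤ y} := (isClosed_Ici (a := k t)).isOpen_compl
  have hL {s t : T} (h : k s ≤ k t) : L s ⊆ L t := fun x hx hx' => hx (h.trans hx')
  let m : T → ℝ := fun t => ν.real (L t)
  have hm {s t : T} (h : k s ≤ k t) : m s ≤ m t := measureReal_mono (hL h)
  have hmm : Measurable m := measurable_of_monotone_of_factors hk hkm
    (fun s t h => hm (hkm h)) fun s t h => le_antisymm (hm h.le) (hm h.ge)
  have hm0 (t : T) : 0 ≤ m t := measureReal_nonneg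
  let q : T → ℕ := fun t => ⌊m t / δ⌋₊
  have hq (t : T) : q t * δ ≤ m t ∧ m t < (q t + 1) * δ :=
    ⟨(le_div_iff₀ hδ).mp (Nat.floor_le (by have := hm0 t; positivity)),
      (div_lt_iff₀ hδ).mp (Nat.lt_floor_add_one _)⟩
  have hqm : Measurable q := Nat.measurable_floor.comp (hmm.div_const δ)
  have hqmono {s t : T} (h : k s ≤ k t) : q s ≤ q t :=
    Nat.floor_mono (div_le_div_of_nonneg_right (hm h) hδ.le)
  let U : ℕ → Set T := fun j => ⋃ t ∈ q ⁻¹' {j}, L t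
  have hUm (j : ℕ) : MeasurableSet (U j) :=
    (isOpen_biUnion fun t _ => (hLo t).preimage hk).measurableSet
  refine ⟨⌊ν.real Set.univ / δ⌋₊ + 1, q, fun j => q ⁻¹' {j} ∩ U j, fun s t h => hqmono (hkm h),
    fun t => Nat.lt_succ_of_le (Nat.floor_mono (div_le_div_of_nonneg_right
      (measureReal_mono (Set.subset_univ _)) hδ.le)), hqm,
    fun j => (hqm (measurableSet_singleton j)).inter (hUm j),
    fun j => Set.inter_subset_left, fun j => ?_, fun s t hst hs ht => ?_⟩
  · rcases (q ⁻¹' {j}).eq_empty_or_nonempty with hJ | ⟨t₁, ht₁⟩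
    · simp [hJ, hδ.le]
    -- the part of the chain below the `j`-th interval
    let D : Set T := {s | m s < j * δ}
    have hDm : MeasurableSet D := measurableSet_lt hmm measurable_const
    have hU : ν (U j) ≤ ENNReal.ofReal ((j + 1) * δ) := by
      refine measure_biUnion_preimage_le ν hk hLo (fun s _ t _ => ?_) fun t ht => ?_
      · exact (le_total s t).imp (fun h => hL (hkm h)) fun h => hL (hkm h)
      · refine (ENNReal.le_ofReal_iff_toReal_le (measure_ne_top _ _) (by positivity)).mpr ?_
        have h := (hq t).2.le
        rwa [show q t = j from ht] at h
    have hU' : ν.real (U j) ≤ (j + 1) * δ := ENNReal.toReal_le_of_le_ofReal (by positivity) hU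
    have hD : j * δ ≤ ν.real D := by
      by_cases h : ∃ t₀, j * δ ≤ m t₀ ∧ ∀ s, j * δ ≤ m s → k t₀ ≤ k s
      · obtain ⟨t₀, ht₀, hmin⟩ := h
        exact ht₀.trans (measureReal_mono fun x hx => not_le.mp fun hxj => hx (hmin x hxj))
      · push Not at h
        have hc : Dᶜ ⊆ ⋃ t ∈ Dᶜ, k ⁻¹' {y | ¬ y ≤ k t} := by
          intro x hx
          obtain ⟨t, ht, hxt⟩ := h x (not_lt.mp hx)
          exact Set.mem_biUnion (show t ∈ Dᶜ from not_lt.mpr ht) hxt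
        have hle : ν (⋃ t ∈ Dᶜ, k ⁻¹' {y | ¬ y ≤ k t}) ≤
            ENNReal.ofReal (ν.real Set.univ - j * δ) := by
          refine measure_biUnion_preimage_le ν hk
            (fun t => (isClosed_Iic (a := k t)).isOpen_compl) (fun s _ t _ => ?_) fun t ht => ?_
          · refine (le_total s t).symm.imp (fun h x hx hx' => ?_) fun h x hx hx' => ?_
            · exact hx (hx'.trans (hkm h))
            · exact hx (hx'.trans (hkm h))
          · have hmeas : MeasurableSet (k ⁻¹' {y | ¬ y ≤ k t}) :=
              ((isClosed_Iic (a := k t)).isOpen_compl.preimage hk).measurableSet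
            have hsub : L t ⊆ (k ⁻¹' {y | ¬ y ≤ k t})ᶜ := fun x hx hx' =>
              (le_total x t).elim (fun h => hx' (hkm h)) fun h => hx (hkm h)
            have h1 : j * δ ≤ ν.real (k ⁻¹' {y | ¬ y ≤ k t})ᶜ :=
              (not_lt.mp (show ¬ m t < j * δ from ht)).trans (measureReal_mono hsub)
            rw [measureReal_compl hmeas] at h1
            have h2 : ν.real (k ⁻¹' {y | ¬ y ≤ k t}) ≤ ν.real Set.univ - j * δ := by linarith
            rwa [ENNReal.le_ofReal_iff_toReal_le (measure_ne_top _ _)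
              (measureReal_nonneg.trans h2)]
        have hjle : j * δ ≤ ν.real Set.univ := by
          have h1 := (hq t₁).1
          rw [show q t₁ = j from ht₁] at h1
          exact h1.trans (measureReal_mono (Set.subset_univ _))
        have hle' : ν.real Dᶜ ≤ ν.real Set.univ - j * δ :=
          ENNReal.toReal_le_of_le_ofReal (by linarith) ((measure_mono hc).trans hle)
        rw [measureReal_compl hDm] at hle'
        linarith
    have hDU : D ⊆ U j := by
      intro x hx
      refine Set.mem_biUnion ht₁ fun hle => ?_
      have h1 := (hq t₁).1
      rw [show q t₁ = j from ht₁] at h1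
      exact absurd (h1.trans (hm hle)) (not_le.mpr hx)
    have hPsub : q ⁻¹' {j} ∩ U j ⊆ U j \ D := by
      rintro x ⟨hx, hxU⟩
      refine ⟨hxU, fun hxD => ?_⟩
      have h1 := (hq x).1
      rw [show q x = j from hx] at h1
      exact absurd h1 (not_le.mpr hxD)
    calc ν.real (q ⁻¹' {j} ∩ U j) ≤ ν.real (U j \ D) := measureReal_mono hPsub
      _ = ν.real (U j) - ν.real D := measureReal_sdiff hDU hDm (measure_ne_top _ _)
      _ ≤ δ := by linarith
  · have hmax {x y : T} (hx : x ∉ q ⁻¹' {q x} ∩ U (q x)) (hxy : q x = q y) : k y ≤ k x := by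
      by_contra hyx
      exact hx ⟨rfl, Set.mem_biUnion (show y ∈ q ⁻¹' {q x} from hxy.symm) hyx⟩
    exact le_antisymm (hmax ht hst.symm) (hmax hs hst)

end Chain

/-! ### Weak integrals of monotone fields -/

section AbsFunctional

variable {E : Type*} [CStarAlgebra E] [PartialOrder E] [StarOrderedRing E]

/-- The modulus of a real functional at a positive element `a`: the supremum of `ψ` over the order
interval `[-a, a]`. -/
noncomputable def functionalAbs (ψ : E →L[ℝ] ℝ) (a : E) : ℝ := sSup (ψ '' Set.Icc (-a) a)

theorem norm_le_of_mem_Icc_neg {a x : E} (h : x ∈ Set.Icc (-a) a) : ‖x‖ ≤ 3 * ‖a‖ := by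
  have h1 : 0 ≤ x + a := neg_le_iff_add_nonneg.mp h.1
  have h2 : ‖x + a‖ ≤ ‖a + a‖ :=
    CStarAlgebra.norm_le_norm_of_nonneg_of_le h1 (add_le_add_left h.2 a)
  have h3 := norm_add_le a a
  have h4 := norm_sub_le (x + a) a
  rw [add_sub_cancel_right] at h4
  linarith

theorem map_le_of_mem_Icc_neg (ψ : E →L[ℝ] ℝ) {a x : E} (h : x ∈ Set.Icc (-a) a) :
    ψ x ≤ 3 * ‖ψ‖ * ‖a‖ :=
  calc ψ x ≤ ‖ψ x‖ := Real.le_norm_self _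
    _ ≤ ‖ψ‖ * ‖x‖ := ψ.le_opNorm x
    _ ≤ ‖ψ‖ * (3 * ‖a‖) := mul_le_mul_of_nonneg_left (norm_le_of_mem_Icc_neg h) (norm_nonneg ψ)
    _ = 3 * ‖ψ‖ * ‖a‖ := by ring

theorem bddAbove_image_Icc_neg (ψ : E →L[ℝ] ℝ) (a : E) : BddAbove (ψ '' Set.Icc (-a) a) :=
  ⟨3 * ‖ψ‖ * ‖a‖, by rintro _ ⟨x, hx, rfl⟩; exact map_le_of_mem_Icc_neg ψ hx⟩

theorem functionalAbs_nonneg (ψ : E →L[ℝ] ℝ) {a : E} (ha : 0 ≤ a) : 0 ≤ functionalAbs ψ a :=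
  le_csSup (bddAbove_image_Icc_neg ψ a) ⟨0, ⟨neg_nonpos.mpr ha, ha⟩, map_zero ψ⟩

theorem functionalAbs_le (ψ : E →L[ℝ] ℝ) {a : E} : functionalAbs ψ a ≤ 3 * ‖ψ‖ * ‖a‖ :=
  Real.sSup_le (by rintro _ ⟨x, hx, rfl⟩; exact map_le_of_mem_Icc_neg ψ hx) (by positivity)

/-- Superadditivity of the modulus: it plays the role of a variation function. -/
theorem functionalAbs_add_abs_le (ψ : E →L[ℝ] ℝ) {a b : E} (ha : 0 ≤ a) (hab : a ≤ b) :
    functionalAbs ψ a + |ψ b - ψ a| ≤ functionalAbs ψ b := by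
  have hne : (ψ '' Set.Icc (-a) a).Nonempty :=
    ⟨ψ 0, 0, ⟨neg_nonpos.mpr ha, ha⟩, rfl⟩
  rw [← le_sub_iff_add_le]
  refine csSup_le hne ?_
  rintro _ ⟨x, hx, rfl⟩
  have h1 : ψ (x + (b - a)) ≤ functionalAbs ψ b := by
    refine le_csSup (bddAbove_image_Icc_neg ψ b) ⟨_, ⟨?_, ?_⟩, rfl⟩
    · calc -b ≤ -a := neg_le_neg hab
        _ ≤ x := hx.1
        _ ≤ x + (b - a) := le_add_of_nonneg_right (sub_nonneg.mpr hab)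
    · calc x + (b - a) ≤ a + (b - a) := add_le_add_left hx.2 _
        _ = b := by abel
  have h2 : ψ (x - (b - a)) ≤ functionalAbs ψ b := by
    refine le_csSup (bddAbove_image_Icc_neg ψ b) ⟨_, ⟨?_, ?_⟩, rfl⟩
    · calc -b = -a - (b - a) := by abel
        _ ≤ x - (b - a) := sub_le_sub_right hx.1 _
    · calc x - (b - a) ≤ x := sub_le_self _ (sub_nonneg.mpr hab)
        _ ≤ a := hx.2
        _ ≤ b := hab
  simp only [map_add, map_sub] at h1 h2
  rcases abs_cases (ψ b - ψ a) with ⟨h, _⟩ | ⟨h, _⟩ <;> rw [h] <;> linarith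

theorem functionalAbs_mono (ψ : E →L[ℝ] ℝ) {a b : E} (ha : 0 ≤ a) (hab : a ≤ b) :
    functionalAbs ψ a ≤ functionalAbs ψ b :=
  (le_add_of_nonneg_right (abs_nonneg _)).trans (functionalAbs_add_abs_le ψ ha hab)

end AbsFunctional

section MonotoneField

variable {T : Type*} [TopologicalSpace T] [LinearOrder T] [MeasurableSpace T]
  [BorelSpace T] {Y : Type*} [PartialOrder Y] [PseudoMetricSpace Y] [OrderClosedTopology Y]
  {k : T → Y} {E : Type*} [CStarAlgebra E] [PartialOrder E] [StarOrderedRing E] {f : T → E}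

theorem measurable_functional_comp (hk : Continuous k) (hkm : Monotone k) (hf : Monotone f)
    (hf0 : ∀ t, 0 ≤ f t) (hfk : ∀ s t, k s = k t → f s = f t) (ψ : E →L[ℝ] ℝ) :
    Measurable fun t => ψ (f t) := by
  have h1 : Measurable fun t => functionalAbs ψ (f t) :=
    measurable_of_monotone_of_factors hk hkm
      (fun s t h => functionalAbs_mono ψ (hf0 s) (hf h)) fun s t h => by rw [hfk s t h]
  have h2 : Measurable fun t => functionalAbs ψ (f t) + ψ (f t) := by
    refine measurable_of_monotone_of_factors hk hkm (fun s t h => ?_)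
      fun s t h => by rw [hfk s t h]
    have h3 := functionalAbs_add_abs_le ψ (hf0 s) (hf h)
    have h4 := neg_abs_le (ψ (f t) - ψ (f s))
    linarith
  have h3 := h2.sub h1
  simpa only [Pi.sub_def, add_sub_cancel_left] using h3

variable (ν : Measure T) [IsFiniteMeasure ν]

theorem integrable_functional_comp (hk : Continuous k) (hkm : Monotone k) (hf : Monotone f)
    (hf0 : ∀ t, 0 ≤ f t) (hfk : ∀ s t, k s = k t → f s = f t) {C : ℝ} (hC : ∀ t, ‖f t‖ ≤ C)
    (ψ : E →L[ℝ] ℝ) : Integrable (fun t => ψ (f t)) ν :=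
  Integrable.of_bound (measurable_functional_comp hk hkm hf hf0 hfk ψ).aestronglyMeasurable
    (‖ψ‖ * C) (Eventually.of_forall fun t => (ψ.le_opNorm _).trans
      (mul_le_mul_of_nonneg_left (hC t) (norm_nonneg ψ)))

variable [CompactSpace T]

/-- Riemann sums over an interval partition approximate all the integrals `∫ ψ (f t) dν`
simultaneously, uniformly for `ψ` in bounded sets: `f` is exact at the large points of the chain,
and elsewhere the error is controlled by the variation of `ψ ∘ f`. -/
theorem exists_approx_integral (hk : Continuous k) (hkm : Monotone k) (hf : Monotone f)
    (hf0 : ∀ t, 0 ≤ f t) (hfk : ∀ s t, k s = k t → f s = f t) {C : ℝ} (hC0 : 0 ≤ C)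
    (hC : ∀ t, ‖f t‖ ≤ C) {δ : ℝ} (hδ : 0 < δ) :
    ∃ S : E, ∀ ψ : E →L[ℝ] ℝ, |∫ t, ψ (f t) ∂ν - ψ S| ≤ δ * (3 * ‖ψ‖ * C) := by
  classical
  obtain ⟨N, q, P, hqmono, hqN, hqm, hPm, hPq, hPδ, hconst⟩ :=
    exists_interval_partition ν hk hkm hδ
  -- sample values on the small part and on the constant part of each interval
  let b : ℕ → E := fun j => if h : ∃ t, q t = j then f h.choose else 0
  let c : ℕ → E := fun j => if h : ∃ t, q t = j ∧ t ∉ P j then f h.choose else 0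
  let g : T → E := fun t => if t ∈ P (q t) then b (q t) else c (q t)
  have hb (t : T) : ∃ s, q s = q t ∧ b (q t) = f s := by
    have h : ∃ s, q s = q t := ⟨t, rfl⟩
    exact ⟨h.choose, h.choose_spec, dif_pos h⟩
  have hc (t : T) (ht : t ∉ P (q t)) : c (q t) = f t := by
    have h : ∃ s, q s = q t ∧ s ∉ P (q t) := ⟨t, rfl, ht⟩
    have h1 : c (q t) = f h.choose := dif_pos h
    rw [h1]
    refine hfk _ _ (hconst _ _ h.choose_spec.1 ?_ ht)
    rw [h.choose_spec.1]
    exact h.choose_spec.2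
  have hset : MeasurableSet {t | t ∈ P (q t)} := by
    have : {t | t ∈ P (q t)} = ⋃ j, P j := by
      ext t
      refine ⟨fun ht => Set.mem_iUnion.mpr ⟨_, ht⟩, fun ht => ?_⟩
      obtain ⟨j, hj⟩ := Set.mem_iUnion.mp ht
      have : q t = j := hPq j hj
      rw [Set.mem_ofPred_eq, this]
      exact hj
    rw [this]
    exact MeasurableSet.iUnion hPm
  have hgm : StronglyMeasurable g :=
    StronglyMeasurable.ite hset
      ((StronglyMeasurable.of_discrete (f := b)).comp_measurable hqm)
      ((StronglyMeasurable.of_discrete (f := c)).comp_measurable hqm)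
  have hgC (t : T) : ‖g t‖ ≤ C := by
    by_cases ht : t ∈ P (q t)
    · obtain ⟨s, -, hs⟩ := hb t
      simp only [g, if_pos ht, hs, hC]
    · simp only [g, if_neg ht, hc t ht, hC]
  have hgi : Integrable g ν :=
    Integrable.of_bound hgm.aestronglyMeasurable C (Eventually.of_forall hgC)
  refine ⟨∫ t, g t ∂ν, fun ψ => ?_⟩
  have hψf := integrable_functional_comp ν hk hkm hf hf0 hfk hC ψ
  rw [← ψ.integral_comp_comm hgi, ← integral_sub hψf (ψ.integrable_comp hgi)]
  let V : T → ℝ := fun t => functionalAbs ψ (f t)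
  have hV0 (t : T) : 0 ≤ V t := functionalAbs_nonneg ψ (hf0 t)
  have hVC (t : T) : V t ≤ 3 * ‖ψ‖ * C :=
    (functionalAbs_le ψ).trans (mul_le_mul_of_nonneg_left (hC t) (by positivity))
  have hVmono : Monotone V := fun s t h => functionalAbs_mono ψ (hf0 s) (hf h)
  have hVf (s t : T) : |ψ (f t) - ψ (f s)| ≤ |V t - V s| := by
    rcases le_total s t with h | h
    · have := functionalAbs_add_abs_le ψ (hf0 s) (hf h)
      exact (le_sub_iff_add_le'.mpr this).trans (le_abs_self _)
    · have := functionalAbs_add_abs_le ψ (hf0 t) (hf h)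
      rw [abs_sub_comm, abs_sub_comm (V t)]
      exact (le_sub_iff_add_le'.mpr this).trans (le_abs_self _)
  -- `σ j` is the supremum of the variation below the `j`-th interval
  let σ : ℕ → ℝ := fun j => sSup (V '' {t | q t < j})
  have hbdd (j : ℕ) : BddAbove (V '' {t | q t < j}) :=
    ⟨3 * ‖ψ‖ * C, by rintro _ ⟨t, -, rfl⟩; exact hVC t⟩
  have hσ0 (j : ℕ) : 0 ≤ σ j := Real.sSup_nonneg (by rintro _ ⟨t, -, rfl⟩; exact hV0 t)
  have hσle (t : T) : σ (q t) ≤ V t := by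
    refine Real.sSup_le ?_ (hV0 t)
    rintro _ ⟨s, hs, rfl⟩
    exact hVmono (le_of_not_ge fun h => absurd (hqmono h) (not_le.mpr hs))
  have hleσ (t : T) : V t ≤ σ (q t + 1) := le_csSup (hbdd _) ⟨t, Nat.lt_succ_self _, rfl⟩
  have hσmono (j : ℕ) : σ j ≤ σ (j + 1) := by
    refine Real.sSup_le ?_ (hσ0 _)
    rintro _ ⟨s, hs, rfl⟩
    exact le_csSup (hbdd _) ⟨s, Nat.lt_succ_of_lt hs, rfl⟩
  have hpt (t : T) : |ψ (f t) - ψ (g t)| ≤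
      ∑ j ∈ Finset.range N, (P j).indicator (fun _ => σ (j + 1) - σ j) t := by
    have hnn : ∀ j ∈ Finset.range N,
        0 ≤ (P j).indicator (fun _ => σ (j + 1) - σ j) t := fun j _ =>
      Set.indicator_nonneg (fun _ _ => sub_nonneg.mpr (hσmono j)) t
    by_cases ht : t ∈ P (q t)
    · obtain ⟨s, hs, hbs⟩ := hb t
      have h1 : g t = f s := by simp only [g, if_pos ht, hbs]
      have h2 := Finset.single_le_sum hnn (Finset.mem_range.mpr (hqN t))
      rw [Set.indicator_of_mem ht] at h2
      refine le_trans ?_ h2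
      rw [h1]
      refine (hVf s t).trans (abs_le.mpr ⟨?_, ?_⟩)
      · have h3 := hleσ s
        have h4 := hσle t
        rw [hs] at h3
        linarith
      · have h3 := hσle s
        have h4 := hleσ t
        rw [hs] at h3
        linarith
    · have h1 : g t = f t := by simp only [g, if_neg ht, hc t ht]
      rw [h1, sub_self, abs_zero]
      exact Finset.sum_nonneg hnn
  have hind (j : ℕ) : Integrable ((P j).indicator fun _ => σ (j + 1) - σ j) ν :=
    (integrable_const _).indicator (hPm j)
  calc |∫ t, ψ (f t) - ψ (g t) ∂ν|
      ≤ ∫ t, |ψ (f t) - ψ (g t)| ∂ν := abs_integral_le_integral_abs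
    _ ≤ ∫ t, ∑ j ∈ Finset.range N, (P j).indicator (fun _ => σ (j + 1) - σ j) t ∂ν :=
        integral_mono (hψf.sub (ψ.integrable_comp hgi)).abs
          (integrable_finsetSum _ fun j _ => hind j) hpt
    _ = ∑ j ∈ Finset.range N, ν.real (P j) * (σ (j + 1) - σ j) := by
        rw [integral_finsetSum _ fun j _ => hind j]
        exact Finset.sum_congr rfl fun j _ => by
          rw [integral_indicator_const _ (hPm j), smul_eq_mul]
    _ ≤ ∑ j ∈ Finset.range N, δ * (σ (j + 1) - σ j) :=
        Finset.sum_le_sum fun j _ =>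
          mul_le_mul_of_nonneg_right (hPδ j) (sub_nonneg.mpr (hσmono j))
    _ = δ * (σ N - σ 0) := by rw [← Finset.mul_sum, Finset.sum_range_sub]
    _ ≤ δ * (3 * ‖ψ‖ * C) := by
        refine mul_le_mul_of_nonneg_left ?_ hδ.le
        have h1 : σ N ≤ 3 * ‖ψ‖ * C :=
          Real.sSup_le (by rintro _ ⟨t, -, rfl⟩; exact hVC t) (by positivity)
        linarith [hσ0 0]

/-- The Riemann sums of `exists_approx_integral` are Cauchy in norm, by the Hahn-Banach theorem. -/
theorem exists_forall_integral_eq (hk : Continuous k) (hkm : Monotone k) (hf : Monotone f)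
    (hf0 : ∀ t, 0 ≤ f t) (hfk : ∀ s t, k s = k t → f s = f t) {C : ℝ} (hC : ∀ t, ‖f t‖ ≤ C) :
    ∃ S : E, ∀ ψ : E →L[ℝ] ℝ, ψ S = ∫ t, ψ (f t) ∂ν := by
  have hC' (t : T) : ‖f t‖ ≤ |C| := (hC t).trans (le_abs_self C)
  choose S hS using fun n : ℕ => exists_approx_integral ν hk hkm hf hf0 hfk (abs_nonneg C) hC'
    (δ := 1 / ((n : ℝ) + 1)) (by positivity)
  have hlim (K : ℝ) : Tendsto (fun n : ℕ => 1 / ((n : ℝ) + 1) * K) atTop (𝓝 0) := by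
    simpa using (tendsto_one_div_add_atTop_nhds_zero_nat (𝕜 := ℝ)).mul_const K
  have hcauchy : CauchySeq S := by
    refine cauchySeq_of_le_tendsto_0 (fun N => 1 / ((N : ℝ) + 1) * (6 * |C|))
      (fun n m N hn hm => ?_) (hlim _)
    have hle {n : ℕ} (hn : N ≤ n) : 1 / ((n : ℝ) + 1) ≤ 1 / ((N : ℝ) + 1) :=
      one_div_le_one_div_of_le (by positivity) (by exact_mod_cast Nat.succ_le_succ hn)
    obtain ⟨ψ, hψ, hψS⟩ := exists_dual_vector'' ℝ (S n - S m)
    have hK : 3 * ‖ψ‖ * |C| ≤ 3 * |C| := by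
      have := mul_le_mul_of_nonneg_right hψ (abs_nonneg C)
      linarith
    have h (n : ℕ) (hn : N ≤ n) : |∫ t, ψ (f t) ∂ν - ψ (S n)| ≤ 1 / ((N : ℝ) + 1) * (3 * |C|) :=
      (hS n ψ).trans (mul_le_mul (hle hn) hK (by positivity) (by positivity))
    rw [dist_eq_norm]
    have h1 : ‖S n - S m‖ = ψ (S n) - ψ (S m) := by
      rw [← map_sub, hψS]; rfl
    have h2 := abs_le.mp (h n hn)
    have h3 := abs_le.mp (h m hm)
    rw [h1]
    linarith [h2.1, h2.2, h3.1, h3.2]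
  obtain ⟨S₀, hS₀⟩ := cauchySeq_tendsto_of_complete hcauchy
  refine ⟨S₀, fun ψ => ?_⟩
  have h1 := (ψ.continuous.tendsto S₀).comp hS₀
  have h2 : Tendsto (fun n => ψ (S n)) atTop (𝓝 (∫ t, ψ (f t) ∂ν)) := by
    rw [tendsto_iff_norm_sub_tendsto_zero]
    refine squeeze_zero (fun _ => norm_nonneg _) (fun n => ?_) (hlim (3 * ‖ψ‖ * |C|))
    rw [Real.norm_eq_abs, abs_sub_comm]
    exact hS n ψ
  exact tendsto_nhds_unique h1 h2

/-- Weak integrability may be tested on real functionals. -/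
theorem hasWeakIntegral_of_real {T : Type*} [MeasurableSpace T] {μ : Measure T} {F : Type*}
    [NormedAddCommGroup F] [NormedSpace ℂ F] {f : T → F} {S : F}
    (h : ∀ ψ : F →L[ℝ] ℝ, Integrable (fun t => ψ (f t)) μ ∧ ψ S = ∫ t, ψ (f t) ∂μ) :
    HasWeakIntegral f μ S := by
  intro φ
  obtain ⟨hr, hr'⟩ := h (Complex.reCLM.comp (φ.restrictScalars ℝ))
  obtain ⟨hi, hi'⟩ := h (Complex.imCLM.comp (φ.restrictScalars ℝ))
  have hint : Integrable (fun t => φ (f t)) μ := by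
    have h1 := hr.ofReal (𝕜 := ℂ) |>.add ((hi.ofReal (𝕜 := ℂ)).mul_const Complex.I)
    refine h1.congr (Eventually.of_forall fun t => ?_)
    exact Complex.re_add_im _
  refine ⟨hint, Complex.ext ?_ ?_⟩
  · exact hr'.trans (Complex.reCLM.integral_comp_comm hint)
  · exact hi'.trans (Complex.imCLM.integral_comp_comm hint)

/-- A bounded increasing field which factors through a norm continuous increasing field is weakly
integrable against any integrable density. -/
theorem exists_hasWeakIntegral_smul (μ : Measure T) (hk : Continuous k) (hkm : Monotone k)
    (hf : Monotone f) (hf0 : ∀ t, 0 ≤ f t) (hfk : ∀ s t, k s = k t → f s = f t) {C : ℝ}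
    (hC : ∀ t, ‖f t‖ ≤ C) {α : T → ℝ} (hαm : Measurable α) (hα0 : ∀ t, 0 ≤ α t)
    (hα : Integrable α μ) : ∃ S : E, HasWeakIntegral (fun t => α t • f t) μ S := by
  let ν : Measure T := μ.withDensity fun t => ENNReal.ofReal (α t)
  have hν : IsFiniteMeasure ν := isFiniteMeasure_withDensity_ofReal hα.2
  obtain ⟨S, hS⟩ := exists_forall_integral_eq ν hk hkm hf hf0 hfk hC
  refine ⟨S, hasWeakIntegral_of_real fun ψ => ?_⟩
  have hm : Measurable fun t => ENNReal.ofReal (α t) := hαm.ennreal_ofReal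
  have hfin : ∀ᵐ t ∂μ, ENNReal.ofReal (α t) < ∞ :=
    Eventually.of_forall fun _ => ENNReal.ofReal_lt_top
  have heq (t : T) : ψ (α t • f t) = (ENNReal.ofReal (α t)).toReal • ψ (f t) := by
    rw [map_smul, ENNReal.toReal_ofReal (hα0 t)]
  simp only [heq]
  exact ⟨(integrable_withDensity_iff_integrable_smul' hm hfin).mp
    (integrable_functional_comp ν hk hkm hf hf0 hfk hC ψ),
    (hS ψ).trans (integral_withDensity_eq_integral_toReal_smul hm hfin _)⟩

end MonotoneField

/-! ### Integration of operator inequalities -/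

section WeakIntegral

open scoped ComplexOrder

variable {T : Type*} [MeasurableSpace T] {μ : Measure T}

section Linear

variable {E F : Type*} [NormedAddCommGroup E] [NormedSpace ℂ E] [NormedAddCommGroup F]
  [NormedSpace ℂ F] {f g : T → E} {S R : E}

theorem HasWeakIntegral.map (h : HasWeakIntegral f μ S) (L : E →L[ℂ] F) :
    HasWeakIntegral (fun t => L (f t)) μ (L S) := fun φ => h (φ.comp L)

theorem HasWeakIntegral.add (hf : HasWeakIntegral f μ S) (hg : HasWeakIntegral g μ R) :
    HasWeakIntegral (fun t => f t + g t) μ (S + R) := fun φ => by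
  obtain ⟨hf1, hf2⟩ := hf φ
  obtain ⟨hg1, hg2⟩ := hg φ
  simp only [map_add]
  exact ⟨hf1.add hg1, by rw [hf2, hg2, integral_add hf1 hg1]⟩

theorem HasWeakIntegral.sub (hf : HasWeakIntegral f μ S) (hg : HasWeakIntegral g μ R) :
    HasWeakIntegral (fun t => f t - g t) μ (S - R) := fun φ => by
  obtain ⟨hf1, hf2⟩ := hf φ
  obtain ⟨hg1, hg2⟩ := hg φ
  simp only [map_sub]
  exact ⟨hf1.sub hg1, by rw [hf2, hg2, integral_sub hf1 hg1]⟩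

theorem HasWeakIntegral.const_smul (c : ℝ) (hf : HasWeakIntegral f μ S) :
    HasWeakIntegral (fun t => c • f t) μ (c • S) := by
  simpa using hf.map ((c : ℂ) • ContinuousLinearMap.id ℂ E)

theorem hasWeakIntegral_integral [CompleteSpace E] (hf : Integrable f μ) :
    HasWeakIntegral f μ (∫ t, f t ∂μ) := fun φ =>
  ⟨φ.integrable_comp hf, (φ.integral_comp_comm hf).symm⟩

theorem hasWeakIntegral_smul_const {α : T → ℝ} (hα : Integrable α μ) (x : E) :
    HasWeakIntegral (fun t => α t • x) μ ((∫ t, α t ∂μ) • x) := fun φ => by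
  have hreal (c : ℝ) : φ (c • x) = c • φ x := (φ.restrictScalars ℝ).map_smul c x
  simp only [hreal]
  exact ⟨hα.smul_const _, (integral_smul_const α (φ x)).symm⟩

end Linear

variable {H : Type*} [NormedAddCommGroup H] [InnerProductSpace ℂ H]

theorem HasWeakIntegral.nonneg {f : T → H →L[ℂ] H} {S : H →L[ℂ] H} (h : HasWeakIntegral f μ S)
    (hf : ∀ t, 0 ≤ f t) : 0 ≤ S := by
  refine nonneg_iff_inner_nonneg.mpr fun x => ?_
  obtain ⟨-, hS⟩ := h ((innerSL ℂ x).comp (ContinuousLinearMap.apply ℂ H x))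
  have hpos (t : T) : 0 ≤ inner ℂ x (f t x) := nonneg_iff_inner_nonneg.mp (hf t) x
  have hS' : inner ℂ x (S x) = ∫ t, inner ℂ x (f t x) ∂μ := hS
  rw [hS']
  have hre (t : T) : inner ℂ x (f t x) = ((inner ℂ x (f t x)).re : ℂ) :=
    Complex.ext rfl (Complex.nonneg_iff.mp (hpos t)).2.symm
  rw [funext hre, integral_complex_ofReal]
  exact Complex.zero_le_real.mpr
    (integral_nonneg fun t => (Complex.nonneg_iff.mp (hpos t)).1)

theorem HasWeakIntegral.mono [CompleteSpace H] {f g : T → H →L[ℂ] H} {S R : H →L[ℂ] H}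
    (hf : HasWeakIntegral f μ S) (hg : HasWeakIntegral g μ R) (h : ∀ t, f t ≤ g t) : S ≤ R :=
  sub_nonneg.mp ((hg.sub hf).nonneg fun t => sub_nonneg.mpr (h t))

end WeakIntegral

/-! ### The Chebyshev inequality -/

section Chebyshev

variable {H : Type*} [NormedAddCommGroup H] [InnerProductSpace ℂ H] [CompleteSpace H]
  {ι : Type*} (e : HilbertBasis ι ℂ H) {T : Type*} [MeasurableSpace T] {μ : Measure T}
  {α : T → ℝ} {f g : T → H →L[ℂ] H} {S R : H →L[ℂ] H}

theorem HasWeakIntegral.hadamard_right (hf : HasWeakIntegral (fun t => α t • f t) μ S)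
    (X : H →L[ℂ] H) :
    HasWeakIntegral (fun t => α t • hadamardProd e (f t) X) μ (hadamardProd e S X) := by
  have h := hf.map ((hadamardCLM e).flip X)
  have hreal (c : ℝ) (Y : H →L[ℂ] H) :
      (hadamardCLM e).flip X (c • Y) = c • hadamardProd e Y X :=
    (((hadamardCLM e).flip X).restrictScalars ℝ).map_smul c Y
  simp only [hreal] at h
  exact h

theorem HasWeakIntegral.hadamard_left (hf : HasWeakIntegral (fun t => α t • f t) μ S)
    (X : H →L[ℂ] H) :
    HasWeakIntegral (fun t => α t • hadamardProd e X (f t)) μ (hadamardProd e X S) := by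
  simpa only [hadamardProd_comm e X] using hf.hadamard_right e X

/-- The pointwise bound `hadamardProd_geomMean_le`, integrated first in `s` and then in `t`. The
two terms on the right integrate to the same operator, so the weights `r` and `1 - r` add up. -/
theorem hadamardProd_integral_geomMean_le {A B : T → H →L[ℂ] H} {SA SB : H →L[ℂ] H}
    (hA0 : ∀ t, 0 ≤ A t) (hB0 : ∀ t, 0 ≤ B t) (hα0 : ∀ t, 0 ≤ α t)
    (hA : HasWeakIntegral (fun t => α t • A t) μ SA)
    (hB : HasWeakIntegral (fun t => α t • B t) μ SB) {r : ℝ} (hr : r ∈ Set.Icc (0 : ℝ) 1)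
    (hS : HasWeakIntegral (fun t => α t • geomMean r (A t) (B t)) μ S)
    (hR : HasWeakIntegral (fun t => α t • geomMean (1 - r) (A t) (B t)) μ R) :
    hadamardProd e S R ≤ hadamardProd e SA SB := by
  have h1 (t : T) : hadamardProd e (geomMean r (A t) (B t)) R ≤
      r • hadamardProd e (B t) SA + (1 - r) • hadamardProd e (A t) SB := by
    refine (hR.hadamard_left e _).mono
      (((hA.hadamard_left e (B t)).const_smul r).add
        ((hB.hadamard_left e (A t)).const_smul (1 - r))) fun s => ?_
    rw [smul_comm r, smul_comm (1 - r), ← smul_add]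
    exact smul_le_smul_of_nonneg_left
      (hadamardProd_geomMean_le e (hA0 t) (hB0 t) (hA0 s) (hB0 s) hr) (hα0 s)
  have h2 : hadamardProd e S R ≤ r • hadamardProd e SB SA + (1 - r) • hadamardProd e SA SB := by
    refine (hS.hadamard_right e R).mono
      (((hB.hadamard_right e SA).const_smul r).add
        ((hA.hadamard_right e SB).const_smul (1 - r))) fun t => ?_
    rw [smul_comm r, smul_comm (1 - r), ← smul_add]
    exact smul_le_smul_of_nonneg_left (h1 t) (hα0 t)
  rwa [hadamardProd_comm e SB SA, ← add_smul, add_sub_cancel, one_smul] at h2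

/-- The Chebyshev inequality for synchronous fields: integrate
`(A t - A s) ∘ (B t - B s) ≥ 0` over both variables. -/
theorem hadamardProd_integral_le [LinearOrder T] {A B : T → H →L[ℂ] H} {SA SB W : H →L[ℂ] H}
    (hAm : Monotone A) (hBm : Monotone B) (hα0 : ∀ t, 0 ≤ α t) (hα : Integrable α μ)
    (hA : HasWeakIntegral (fun t => α t • A t) μ SA)
    (hB : HasWeakIntegral (fun t => α t • B t) μ SB)
    (hW : HasWeakIntegral (fun t => α t • hadamardProd e (A t) (B t)) μ W) :
    hadamardProd e SA SB ≤ (∫ t, α t ∂μ) • W := by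
  set c := ∫ t, α t ∂μ
  have hsub (X X' Z Z' : H →L[ℂ] H) : hadamardProd e (X - X') (Z - Z') =
      hadamardProd e X Z + hadamardProd e X' Z' -
        (hadamardProd e X Z' + hadamardProd e X' Z) := by
    simp only [← hadamardCLM_apply, map_sub, sub_apply]
    abel
  have h0 (t s : T) : hadamardProd e (A t) (B s) + hadamardProd e (A s) (B t) ≤
      hadamardProd e (A t) (B t) + hadamardProd e (A s) (B s) := by
    rw [← sub_nonneg, ← hsub]
    rcases le_total s t with h | h
    · exact hadamardProd_nonneg e (sub_nonneg.mpr (hAm h)) (sub_nonneg.mpr (hBm h))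
    · have h1 := hadamardProd_nonneg e (sub_nonneg.mpr (hAm h)) (sub_nonneg.mpr (hBm h))
      rw [hsub] at h1 ⊢
      convert h1 using 1
      abel
  have h1 (t : T) : hadamardProd e (A t) SB + hadamardProd e SA (B t) ≤
      c • hadamardProd e (A t) (B t) + W := by
    refine ((hB.hadamard_left e (A t)).add (hA.hadamard_right e (B t))).mono
      ((hasWeakIntegral_smul_const hα _).add hW) fun s => ?_
    rw [← smul_add, ← smul_add]
    exact smul_le_smul_of_nonneg_left (h0 t s) (hα0 s)
  have h2 : hadamardProd e SA SB + hadamardProd e SA SB ≤ c • W + c • W := by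
    refine ((hA.hadamard_right e SB).add (hB.hadamard_left e SA)).mono
      ((hW.const_smul c).add (hasWeakIntegral_smul_const hα W)) fun t => ?_
    rw [smul_comm c, ← smul_add, ← smul_add]
    exact smul_le_smul_of_nonneg_left (h1 t) (hα0 t)
  rw [← two_smul ℝ, ← two_smul ℝ (c • W)] at h2
  exact le_of_smul_le_smul_left h2 two_pos

end Chebyshev

/-! ### Proof of the integral inequality -/

theorem integrable_smul_of_continuous {T : Type*} [TopologicalSpace T] [CompactSpace T]
    [MeasurableSpace T] [OpensMeasurableSpace T] {μ : Measure T} {E : Type*}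
    [NormedAddCommGroup E] [NormedSpace ℝ E] {α : T → ℝ} (hα : Integrable α μ) {f : T → E}
    (hf : Continuous f) : Integrable (fun t => α t • f t) μ := by
  obtain ⟨C, hC⟩ := (isCompact_range hf).isBounded.exists_norm_le
  have hm : AEStronglyMeasurable f μ :=
    (hf.stronglyMeasurable_of_hasCompactSupport
      (HasCompactSupport.of_compactSpace f)).aestronglyMeasurable
  exact hα.smul_bdd C hm (Eventually.of_forall fun t => hC _ ⟨t, rfl⟩)

end OperatorChebyshev

open OperatorChebyshev
theorem mainTheorem3 {H : Type*} [NormedAddCommGroup H] [InnerProductSpace ℂ H] [CompleteSpace H]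
    {ι : Type*} (e : HilbertBasis ι ℂ H)
    {T : Type*} [TopologicalSpace T] [CompactSpace T] [T2Space T] [LinearOrder T]
    [MeasurableSpace T] [BorelSpace T] (μ : Measure T) [μ.Regular]
    (A B : T → H →L[ℂ] H) (hAc : Continuous A) (hBc : Continuous B)
    (hA0 : ∀ t, 0 ≤ A t) (hB0 : ∀ t, 0 ≤ B t) (hAm : Monotone A) (hBm : Monotone B)
    (α : T → ℝ) (hαm : Measurable α) (hα0 : ∀ t, 0 ≤ α t) (hα : Integrable α μ)
    (r : ℝ) (hr : r ∈ Set.Icc (0 : ℝ) 1) :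
    Integrable (fun t => α t • hadamardProd e (A t) (B t)) μ ∧
      ∃ S R : H →L[ℂ] H,
        HasWeakIntegral (fun t => α t • geomMean r (A t) (B t)) μ S ∧
        HasWeakIntegral (fun s => α s • geomMean (1 - r) (A s) (B s)) μ R ∧
        hadamardProd e S R ≤
          (∫ s, α s ∂μ) • ∫ t, α t • hadamardProd e (A t) (B t) ∂μ := by
  have hk : Continuous fun t => (A t, B t) := hAc.prodMk hBc
  have hkm : Monotone fun t => (A t, B t) := hAm.prodMk hBm
  obtain ⟨C, hC⟩ := (isCompact_range (hAc.add hBc)).isBounded.exists_norm_le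
  have hex (p : ℝ) (hp : p ∈ Set.Icc (0 : ℝ) 1) : ∃ S : H →L[ℂ] H,
      HasWeakIntegral (fun t => α t • geomMean p (A t) (B t)) μ S := by
    refine exists_hasWeakIntegral_smul (C := C) μ hk hkm
      (fun s t h => geomMean_mono hp (hA0 s) (hB0 s) (hAm h) (hBm h))
      (fun t => geomMean_nonneg hp (hA0 t) (hB0 t)) (fun s t h => ?_) (fun t => ?_) hαm hα0 hα
    · rw [(Prod.mk.inj h).1, (Prod.mk.inj h).2]
    · exact (CStarAlgebra.norm_le_norm_of_nonneg_of_le (geomMean_nonneg hp (hA0 t) (hB0 t))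
        (geomMean_le_add hp (hA0 t) (hB0 t))).trans (hC _ ⟨t, rfl⟩)
  obtain ⟨S, hS⟩ := hex r hr
  obtain ⟨R, hR⟩ := hex (1 - r) ⟨by linarith [hr.2], by linarith [hr.1]⟩
  have hABc : Continuous fun t => hadamardProd e (A t) (B t) := by
    have h := (hadamardCLM e).continuous₂.comp hk
    exact h
  have hAB := integrable_smul_of_continuous hα hABc
  have hA := hasWeakIntegral_integral (integrable_smul_of_continuous hα hAc)
  have hB := hasWeakIntegral_integral (integrable_smul_of_continuous hα hBc)
  exact ⟨hAB, S, R, hS, hR, (hadamardProd_integral_geomMean_le e hA0 hB0 hα0 hA hB hr hS hR).trans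
    (hadamardProd_integral_le e hAm hBm hα0 hα hA hB (hasWeakIntegral_integral hAB))⟩
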